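/- **Setting.** Let $H\in\mathbb R^{m\times n}$ and $y=H\theta+w$, where $\theta\in\mathbb R^n$ is the unknown parameter and the noise $w\in\mathbb R^m$ has, given $\theta$, a law with finite covariance. For a family $(P_\vartheta)$ of laws of a random variable $x$, indexed by $\vartheta\in\mathbb R^r$, the *Fisher information matrix* at $\vartheta$ is $$\mathcal I_x(\vartheta)=\mathbb E\big[(\partial_\vartheta\ln p(x|\vartheta))(\partial_\vartheta\ln p(x|\vartheta))^\top\,\big|\,\vartheta\big],$$ where $p(\cdot|\vartheta)$ is a density with respect to a $\sigma$-finite measure $\nu$. Whenever such a score $\partial_\vartheta\ln p(x|\vartheta)$ is used, the usual regularity is understood: at the point $\vartheta$ the density is differentiable in the parameter for $\nu$-almost every outcome, with $\nu$-integrable derivative, and for every bounded measurable $h$ the integral $\int h\,p(\cdot|\vartheta)\,d\nu$ may be differentiated under the integral sign. A Fisher information matrix exists only if its entries are finite. Assume $\mathcal I_w(\theta)=0$ for all $\theta$. Matrix inequalities are in the Loewner order. A *stochastic obfuscation mechanism* $(M,f_d)$ consists of a measurable map $M:\mathbb R^m\times\mathbb R^k\to\mathbb R^q$ and a probability density $f_d$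 on $\mathbb R^k$ ($k,q$ arbitrary). It outputs $z=M(y,d)$, where $d\sim f_d$ is independent of $w$ and $\theta$. It is *admissible* if $M$ and $f_d$ are piecewise continuously differentiable (that is, $C^1$ on an open set whose complement is Lebesgue-null) and, for all $\theta$, $$\mathbb E\big[(\partial_\theta\ln p(z|d,\theta))(\partial_\theta\ln p(z|w,\theta))^\top\,\big|\,\theta\big]=0,$$ where the scores and this expectation are assumed to exist. Given a positive semidefinite $S\in\mathbb R^{m\times m}$, the *privacy constraint* $\mathcal I_z(y)\le S$ means that $\mathcal I_z(y)$ exists and is $\le S$ at every $y\in\mathbb R^m$. The *privacy-preserving Fisher information matrix* $\mathcal{PI}_{y|S}(\theta)$ is the supremum of $\mathcal I_z(\theta)$ over all admissible mechanisms that satisfy the privacy constraint and for which $\mathcal I_z(\theta)$ exists, i.e. the unique symmetric matrix $\bar A$ with $v^\top\bar Av=\sup v^\top\mathcal I_z(\theta)v$ for all $v\in\mathbb R^n$. **Theorem.** Let $H^\top SH$ be invertible, fix $\theta$, and suppose that $\mathcal I_y(H\theta)$ exists, i.e. the Fisher information at $\eta=H\theta$ of the family of laws of $\eta+w$, $\eta\in\mathbb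 R^m$. Put $$\Sigma_{\rm PPCR}=\Big(H^\top S^{1/2}\big(S^{1/2}\,\mathcal I_y(H\theta)^{-1}S^{1/2}+I_m\big)^{-1}S^{1/2}H\Big)^{-1}.$$ 1. For every admissible mechanism with $\mathcal I_z(y)\le S$ and every unbiased estimator $\hat\theta(z)$ of $\theta$ such that $\mathbb E[\hat\theta(z)|\theta]$ is differentiable at $\theta$ with $\partial_{\theta_j}\mathbb E[\hat\theta_i(z)|\theta]=\mathbb E[\hat\theta_i(z)\,\partial_{\theta_j}\ln p(z|\theta)\,|\,\theta]$ for all $i,j$ (the score and these expectations being assumed to exist), $$\mathbb E\big[(\hat\theta(z)-\theta)(\hat\theta(z)-\theta)^\top\,\big|\,\theta\big]\ \ge\ \Sigma_{\rm PPCR},$$ in the sense that $\mathbb E[(v^\top(\hat\theta(z)-\theta))^2|\theta]\ge v^\top\Sigma_{\rm PPCR}v$ for all $v\in\mathbb R^n$, where the left side may be infinite. 2. If $w\sim\mathcal N(\mu_w,\Sigma_w)$, then the mechanism $z=S^{1/2}(y-\mu_w)+d$, $d\sim\mathcal N(0,I_m)$, is admissible and satisfies $\mathcal I_z(y)\le S$,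 and the weighted least-squares estimator $$\hat\theta(z)=\Sigma_{\rm PPCR}H^\top S^{1/2}\big(S^{1/2}\Sigma_wS^{1/2}+I_m\big)^{-1}z$$ is an unbiased estimator as in part 1, with error covariance exactly $\Sigma_{\rm PPCR}$. In this case $\mathcal{PI}_{y|S}(\theta)$ exists and equals $\Sigma_{\rm PPCR}^{-1}$. -/

import Mathlib

open MeasureTheory ProbabilityTheory
open scoped Matrix MatrixOrder

noncomputable section

namespace PPCR

/-! ### Scores and Fisher information -/

/-- `s` is the score `∂ ln p(z | θ) / ∂θ` at the point `θ` of the statistical model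
`(P θ')`, `θ' ∈ ℝ^ι`: the model has densities `p θ'` with respect to some σ-finite measure `ν`,
the density is differentiable in the parameter at `θ` for almost every outcome, one may
differentiate `∫ h(z) p(z | θ') dν(z)` at `θ` under the integral sign for all bounded measurable
`h` (the usual regularity condition), and `s` is the gradient of the log-density. -/
def IsScoreAt {ι Z : Type*} [Fintype ι] [DecidableEq ι] [MeasurableSpace Z]
    (P : (ι → ℝ) → Measure Z) (θ : ι → ℝ) (s : Z → ι → ℝ) : Prop :=
  ∃ (ν : Measure Z) (p : (ι → ℝ) → Z → ℝ),
    SigmaFinite ν ∧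
    (∀ θ', Measurable (p θ') ∧ (∀ z, 0 ≤ p θ' z) ∧
      P θ' = ν.withDensity (fun z => ENNReal.ofReal (p θ' z))) ∧
    (∀ᵐ z ∂ν, DifferentiableAt ℝ (fun θ' => p θ' z) θ) ∧
    Integrable (fun z => fderiv ℝ (fun θ' => p θ' z) θ) ν ∧
    (∀ h : Z → ℝ, Measurable h → (∃ C, ∀ z, |h z| ≤ C) →
      HasFDerivAt (fun θ' => ∫ z, h z * p θ' z ∂ν)
        (∫ z, h z • fderiv ℝ (fun θ' => p θ' z) θ ∂ν) θ) ∧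
    (∀ᵐ z ∂(P θ), ∀ i, s z i = fderiv ℝ (fun θ' => Real.log (p θ' z)) θ (Pi.single i 1))

/-- The Fisher information matrix of the model `P` at `θ` exists (as a finite matrix) and equals
`J = E[(∂ ln p / ∂θ) (∂ ln p / ∂θ)ᵀ | θ]`. -/
def HasFisherInfo {ι Z : Type*} [Fintype ι] [DecidableEq ι] [MeasurableSpace Z]
    (P : (ι → ℝ) → Measure Z) (θ : ι → ℝ) (J : Matrix ι ι ℝ) : Prop :=
  ∃ s : Z → ι → ℝ, IsScoreAt P θ s ∧ (∀ i, MemLp (fun z => s z i) 2 (P θ)) ∧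
    ∀ i j, J i j = ∫ z, s z i * s z j ∂(P θ)

/-! ### Estimators -/

/-- `T` is an unbiased estimator of the parameter of the model `P`. -/
def IsUnbiased {n : ℕ} {Z : Type*} [MeasurableSpace Z]
    (P : (Fin n → ℝ) → Measure Z) (T : Z → Fin n → ℝ) : Prop :=
  Measurable T ∧ ∀ θ i, Integrable (fun z => T z i) (P θ) ∧ ∫ z, T z i ∂(P θ) = θ i

/-- The expectation `E[T | θ']` is differentiable at `θ`, its derivative being obtained by
differentiating under the integral sign: `∂E[T_i | θ]/∂θ_j = E[T_i ∂ln p(z | θ)/∂θ_j | θ]`. This is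
the regularity condition on the estimator in the Cramér–Rao theorem. -/
def IsRegularEstimatorAt {n : ℕ} {Z : Type*} [MeasurableSpace Z]
    (P : (Fin n → ℝ) → Measure Z) (T : Z → Fin n → ℝ) (θ : Fin n → ℝ) : Prop :=
  ∃ s : Z → Fin n → ℝ, IsScoreAt P θ s ∧
    (∀ i j, Integrable (fun z => T z i * s z j) (P θ)) ∧
    ∀ i, HasFDerivAt (fun θ' => ∫ z, T z i ∂(P θ'))
      (∑ j, (∫ z, T z i * s z j ∂(P θ)) •
        (ContinuousLinearMap.proj j : (Fin n → ℝ) →L[ℝ] ℝ)) θ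

/-- The error covariance matrix `E[(T - θ)(T - θ)ᵀ | θ]` (meaningful if `T` has finite second
moments). -/
def errorCov {n : ℕ} {Z : Type*} [MeasurableSpace Z]
    (P : (Fin n → ℝ) → Measure Z) (T : Z → Fin n → ℝ) (θ : Fin n → ℝ) : Matrix (Fin n) (Fin n) ℝ :=
  Matrix.of fun i j => ∫ z, (T z i - θ i) * (T z j - θ j) ∂(P θ)

/-- `E[(T - θ)(T - θ)ᵀ | θ] ≥ R` in the Loewner order, tested on vectors so that infinite second
moments are allowed: `E[(vᵀ(T - θ))² | θ] ≥ vᵀ R v` for all `v`. -/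
def ErrorCovGE {n : ℕ} {Z : Type*} [MeasurableSpace Z]
    (P : (Fin n → ℝ) → Measure Z) (T : Z → Fin n → ℝ) (θ : Fin n → ℝ)
    (R : Matrix (Fin n) (Fin n) ℝ) : Prop :=
  ∀ v : Fin n → ℝ, ENNReal.ofReal (v ⬝ᵥ (R *ᵥ v)) ≤
    ∫⁻ z, ENNReal.ofReal ((v ⬝ᵥ (T z - θ)) ^ 2) ∂(P θ)

/-! ### Stochastic obfuscation mechanisms -/

/-- Piecewise continuously differentiable: `f` is `C¹` on an open set with Lebesgue-null complement
(the pieces are the connected components of that set). -/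
def PiecewiseC1 {E F : Type*} [NormedAddCommGroup E] [NormedSpace ℝ E] [MeasureSpace E]
    [NormedAddCommGroup F] [NormedSpace ℝ F] (f : E → F) : Prop :=
  ∃ U : Set E, IsOpen U ∧ volume Uᶜ = 0 ∧ ContDiffOn ℝ 1 f U

/-- A stochastic obfuscation mechanism `(M, f_d)`: it turns the sensitive value `y ∈ ℝ^m` into
`z = M(y, d) ∈ ℝ^q`, where the privacy noise `d ∈ ℝ^k` has probability density `f_d`. -/
structure Mechanism (m k q : ℕ) where
  /-- The function `M`. -/
  M : (Fin m → ℝ) → (Fin k → ℝ) → (Fin q → ℝ)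
  /-- The density `f_d`. -/
  f : (Fin k → ℝ) → ℝ
  measurable_M : Measurable (Function.uncurry M)
  measurable_f : Measurable f
  f_nonneg : ∀ d, 0 ≤ f d
  integral_f : ∫ d, f d = 1

namespace Mechanism

variable {m n k q : ℕ}

/-- The law of the privacy noise `d`. -/
def noise (A : Mechanism m k q) : Measure (Fin k → ℝ) :=
  volume.withDensity (fun d => ENNReal.ofReal (A.f d))

/-- The law of `z` given the sensitive value `y`. -/
def lawGivenY (A : Mechanism m k q) (y : Fin m → ℝ) : Measure (Fin q → ℝ) :=
  A.noise.map (fun d => A.M y d)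

/-- The law of `z = M(Hθ + w, d)` given `θ`, where `w` has law `W θ` and `d` is independent of
`w`. -/
def lawGivenθ (A : Mechanism m k q) (H : Matrix (Fin m) (Fin n) ℝ)
    (W : (Fin n → ℝ) → Measure (Fin m → ℝ)) (θ : Fin n → ℝ) : Measure (Fin q → ℝ) :=
  ((W θ).prod A.noise).map (fun x => A.M (H *ᵥ θ + x.1) x.2)

/-- The law of `z = M(Hθ + w, d)` given `d` and `θ`. -/
def lawGivenDθ (A : Mechanism m k q) (H : Matrix (Fin m) (Fin n) ℝ)
    (W : (Fin n → ℝ) → Measure (Fin m → ℝ)) (d : Fin k → ℝ) (θ : Fin n → ℝ) :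
    Measure (Fin q → ℝ) :=
  (W θ).map (fun w => A.M (H *ᵥ θ + w) d)

/-- The law of `z = M(Hθ + w, d)` given `w` and `θ`. -/
def lawGivenWθ (A : Mechanism m k q) (H : Matrix (Fin m) (Fin n) ℝ)
    (w : Fin m → ℝ) (θ : Fin n → ℝ) : Measure (Fin q → ℝ) :=
  A.noise.map (fun d => A.M (H *ᵥ θ + w) d)

/-- Admissibility: `M` and `f_d` are piecewise continuously differentiable, and for all `θ`
`E[(∂ ln p(z | d, θ) / ∂θ) (∂ ln p(z | w, θ) / ∂θ)ᵀ | θ] = 0`. -/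
def Admissible (A : Mechanism m k q) (H : Matrix (Fin m) (Fin n) ℝ)
    (W : (Fin n → ℝ) → Measure (Fin m → ℝ)) : Prop :=
  PiecewiseC1 (Function.uncurry A.M) ∧ PiecewiseC1 A.f ∧
  ∀ θ : Fin n → ℝ, ∃ (sD : (Fin k → ℝ) → (Fin q → ℝ) → Fin n → ℝ)
      (sW : (Fin m → ℝ) → (Fin q → ℝ) → Fin n → ℝ),
    Measurable (Function.uncurry sD) ∧ Measurable (Function.uncurry sW) ∧
    (∀ᵐ d ∂A.noise, IsScoreAt (A.lawGivenDθ H W d) θ (sD d)) ∧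
    (∀ᵐ w ∂(W θ), IsScoreAt (A.lawGivenWθ H w) θ (sW w)) ∧
    ∀ i j,
      Integrable (fun x : (Fin m → ℝ) × (Fin k → ℝ) =>
        sD x.2 (A.M (H *ᵥ θ + x.1) x.2) i * sW x.1 (A.M (H *ᵥ θ + x.1) x.2) j)
        ((W θ).prod A.noise) ∧
      ∫ x : (Fin m → ℝ) × (Fin k → ℝ),
        sD x.2 (A.M (H *ᵥ θ + x.1) x.2) i * sW x.1 (A.M (H *ᵥ θ + x.1) x.2) j
        ∂((W θ).prod A.noise) = 0

/-- The privacy constraint `I_z(y) ≤ S` (Loewner order), at every sensitive value `y`. -/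
def Private (A : Mechanism m k q) (S : Matrix (Fin m) (Fin m) ℝ) : Prop :=
  ∀ y, ∃ I : Matrix (Fin m) (Fin m) ℝ, HasFisherInfo A.lawGivenY y I ∧ I ≤ S

end Mechanism

/-! ### Privacy-preserving Fisher information -/

/-- The symmetric matrix `A` is the supremum of the family `F`: it is the unique symmetric matrix
with `vᵀ A v = sup_{B ∈ F} vᵀ B v` for all `v`. -/
def IsMatrixSup {n : ℕ} (F : Set (Matrix (Fin n) (Fin n) ℝ)) (A : Matrix (Fin n) (Fin n) ℝ) :
    Prop :=
  (A.IsSymm ∧ ∀ v : Fin n → ℝ, IsLUB ((fun B => v ⬝ᵥ (B *ᵥ v)) '' F) (v ⬝ᵥ (A *ᵥ v))) ∧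
  ∀ A' : Matrix (Fin n) (Fin n) ℝ,
    (A'.IsSymm ∧ ∀ v : Fin n → ℝ, IsLUB ((fun B => v ⬝ᵥ (B *ᵥ v)) '' F) (v ⬝ᵥ (A' *ᵥ v))) →
    A' = A

/-- The privacy-preserving Fisher information matrix at `θ` exists and equals `A`: `A` is the
supremum of `I_z(θ)` over all admissible mechanisms with `I_z(y) ≤ S`. -/
def IsPrivacyPreservingFisherInfo {m n : ℕ} (H : Matrix (Fin m) (Fin n) ℝ)
    (W : (Fin n → ℝ) → Measure (Fin m → ℝ)) (S : Matrix (Fin m) (Fin m) ℝ) (θ : Fin n → ℝ)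
    (A : Matrix (Fin n) (Fin n) ℝ) : Prop :=
  IsMatrixSup {I | ∃ (k q : ℕ) (B : Mechanism m k q),
    B.Admissible H W ∧ B.Private S ∧ HasFisherInfo (B.lawGivenθ H W) θ I} A

/-- The location family `η ↦ law of η + w`, where `w` has law `μ`. -/
def locationFamily {m : ℕ} (μ : Measure (Fin m → ℝ)) (η : Fin m → ℝ) : Measure (Fin m → ℝ) :=
  μ.map (fun w => η + w)

/-- `Σ_PPCR = (Hᵀ S^{1/2} (S^{1/2} J⁻¹ S^{1/2} + I)⁻¹ S^{1/2} H)⁻¹`, where `J = I_y(Hθ)`. -/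
def sigmaPPCR {m n : ℕ} (H : Matrix (Fin m) (Fin n) ℝ) (S J : Matrix (Fin m) (Fin m) ℝ) :
    Matrix (Fin n) (Fin n) ℝ :=
  (Hᵀ * CFC.sqrt S * (CFC.sqrt S * J⁻¹ * CFC.sqrt S + 1)⁻¹ * CFC.sqrt S * H)⁻¹

/-! ### The Gaussian mechanism -/

/-- The Gaussian law `N(μ, Γ)` on `ℝ^m`. -/
def gaussianLaw {m : ℕ} (μ : Fin m → ℝ) (Γ : Matrix (Fin m) (Fin m) ℝ) : Measure (Fin m → ℝ) :=
  (multivariateGaussian (WithLp.toLp 2 μ) Γ).map WithLp.ofLp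

/-- The Gaussian mechanism `z = S^{1/2} (y - μ) + d` with `d ∼ N(0, I_m)`. -/
def gaussianMechanism {m : ℕ} (S : Matrix (Fin m) (Fin m) ℝ) (μ : Fin m → ℝ) :
    Mechanism m m m where
  M y d := CFC.sqrt S *ᵥ (y - μ) + d
  f d := ∏ i, gaussianPDFReal 0 1 (d i)
  measurable_M := by
    apply Continuous.measurable
    simp only [Function.uncurry_def]
    fun_prop
  measurable_f := Finset.measurable_prod _ fun i _ =>
    (measurable_gaussianPDFReal 0 1).comp (measurable_pi_apply i)
  f_nonneg d := Finset.prod_nonneg fun i _ => gaussianPDFReal_nonneg 0 1 (d i)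
  integral_f := by
    rw [integral_fintype_prod_volume_eq_prod (fun (_ : Fin m) x => gaussianPDFReal 0 1 x)]
    simp [integral_gaussianPDFReal_eq_one]

/-- The weighted least-squares estimator
`z ↦ Σ_PPCR Hᵀ S^{1/2} (S^{1/2} Γ S^{1/2} + I)⁻¹ z` for the output of the Gaussian mechanism, which
is already centred. -/
def wlsEstimator {m n : ℕ} (H : Matrix (Fin m) (Fin n) ℝ) (S J Γ : Matrix (Fin m) (Fin m) ℝ)
    (z : Fin m → ℝ) : Fin n → ℝ :=
  (sigmaPPCR H S J * Hᵀ * CFC.sqrt S * (CFC.sqrt S * Γ * CFC.sqrt S + 1)⁻¹) *ᵥ z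

end PPCR

end

namespace PPCR

/-! ### Linear algebra -/

section LinearAlgebra

variable {m n : ℕ}

/-! The core is an upper bound on the information that the output of a private mechanism carries
about `θ`. Zero Fisher information of `w` at every parameter makes its law independent of `θ`
(`eq_of_hasFisherInfo_zero`). Hence, for bounded `φ`, `E[φ(z) | θ'] = F(Hθ')`, where `F(η)` is the
expectation of `φ(z)` when `y = η + w`.

Split a direction `Hv` as `a + b`. Along `a`, the law of `y` is moved: the derivative of `F` is
controlled by `J` and the variance of the conditional mean `ψ(y) = E[φ(z) | y]`. Along `b`, `ψ` is
differentiated inside the expectation: its derivative is controlled by the privacy bound `S` and the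
conditional variance of `φ(z)`. By the law of total variance the two variances add up to that of
`φ(z)`, so Cauchy–Schwarz bounds the squared derivative by `(aᵀJa + bᵀSb) E[φ²]`
(`sq_hasFDerivAt_kernel_le`). The best split gives the parallel sum of `J` and `S`, pulled back by
`H`, which is `infoMatrix = Σ_PPCR⁻¹` (`exists_add_eq_infoMatrix`). Duality turns the bound over all
bounded `φ` into an `L²` bound on the score (`Mechanism.Private.score_sq_le`), and the Cramér–Rao
inequality gives the first part. The inverse `J⁻¹` is genuine because a location family has no
direction without information (`HasFisherInfo.posDef_of_locationFamily`).

For attainment, every Gaussian law involved is a shift family `N(c + RRᵀBθ, RRᵀ)`, whose score is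
affine in the outcome and whose information is `BᵀRRᵀB`; no invertibility of `RRᵀ` is needed. With
Gaussian noise, `J = Γ⁻¹` and the information of the output equals `infoMatrix`. The error of the
least-squares estimator is `infoMatrix⁻¹` times the score, so Cramér–Rao is an equality, and the
supremum defining the privacy-preserving information is a maximum. -/

lemma sqrt_posSemidef (S : Matrix (Fin m) (Fin m) ℝ) : (CFC.sqrt S).PosSemidef :=
  Matrix.nonneg_iff_posSemidef.1 (CFC.sqrt_nonneg S)

lemma sqrt_transpose (S : Matrix (Fin m) (Fin m) ℝ) : (CFC.sqrt S)ᵀ = CFC.sqrt S := by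
  have h := (sqrt_posSemidef S).isHermitian
  rwa [Matrix.IsHermitian, Matrix.conjTranspose_eq_transpose_of_trivial] at h

lemma sqrt_mul_sqrt {S : Matrix (Fin m) (Fin m) ℝ} (hS : S.PosSemidef) :
    CFC.sqrt S * CFC.sqrt S = S :=
  CFC.sqrt_mul_sqrt_self S hS.nonneg

/-- `Hᵀ S^{1/2} (S^{1/2} J⁻¹ S^{1/2} + I)⁻¹ S^{1/2} H`, the inverse of `Σ_PPCR`. -/
noncomputable def infoMatrix (H : Matrix (Fin m) (Fin n) ℝ) (S J : Matrix (Fin m) (Fin m) ℝ) :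
    Matrix (Fin n) (Fin n) ℝ :=
  Hᵀ * CFC.sqrt S * (CFC.sqrt S * J⁻¹ * CFC.sqrt S + 1)⁻¹ * CFC.sqrt S * H

lemma sqrt_mul_mul_sqrt_add_one_posDef (S : Matrix (Fin m) (Fin m) ℝ)
    {G : Matrix (Fin m) (Fin m) ℝ} (hG : G.PosSemidef) :
    (CFC.sqrt S * G * CFC.sqrt S + 1).PosDef := by
  refine Matrix.PosDef.posSemidef_add ?_ Matrix.PosDef.one
  have h := hG.conjTranspose_mul_mul_same (CFC.sqrt S)
  rwa [Matrix.conjTranspose_eq_transpose_of_trivial, sqrt_transpose] at h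

/-- Invertibility of `HᵀSH` makes `S^{1/2}H` injective, and a congruence by an injective matrix
preserves positive definiteness. -/
lemma infoMatrix_posDef (H : Matrix (Fin m) (Fin n) ℝ) {S J : Matrix (Fin m) (Fin m) ℝ}
    (hS : S.PosSemidef) (hHSH : IsUnit (Hᵀ * S * H)) (hJ : J.PosSemidef) :
    (infoMatrix H S J).PosDef := by
  have hQ := (sqrt_mul_mul_sqrt_add_one_posDef S hJ.inv).inv
  have hinj : Function.Injective (CFC.sqrt S * H).mulVec := by
    intro x y hxy
    apply Matrix.mulVec_injective_of_isUnit hHSH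
    have : Hᵀ * S * H = (Hᵀ * CFC.sqrt S) * (CFC.sqrt S * H) := by
      rw [Matrix.mul_assoc Hᵀ (CFC.sqrt S), ← Matrix.mul_assoc (CFC.sqrt S) (CFC.sqrt S),
        sqrt_mul_sqrt hS, Matrix.mul_assoc]
    simp only [this, ← Matrix.mulVec_mulVec _ (Hᵀ * CFC.sqrt S)]
    exact congrArg (fun u => (Hᵀ * CFC.sqrt S) *ᵥ u) hxy
  have h := hQ.conjTranspose_mul_mul_same hinj
  rw [Matrix.conjTranspose_eq_transpose_of_trivial, Matrix.transpose_mul, sqrt_transpose] at h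
  simpa only [infoMatrix, Matrix.mul_assoc] using h

/-- The parallel sum as an infimal convolution: `H v` splits as `a + b` with
`aᵀ J a + bᵀ S b` equal to the quadratic form of `infoMatrix`. -/
lemma exists_add_eq_infoMatrix (H : Matrix (Fin m) (Fin n) ℝ) {S J : Matrix (Fin m) (Fin m) ℝ}
    (hS : S.PosSemidef) (hJ : J.PosDef) (v : Fin n → ℝ) :
    ∃ a b : Fin m → ℝ, a + b = H *ᵥ v ∧
      a ⬝ᵥ (J *ᵥ a) + b ⬝ᵥ (S *ᵥ b) = v ⬝ᵥ (infoMatrix H S J *ᵥ v) := by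
  set R := CFC.sqrt S with hR
  have hRt : Rᵀ = R := sqrt_transpose S
  set Q := R * J⁻¹ * R + 1 with hQ
  have hQu : IsUnit Q.det := (Matrix.isUnit_iff_isUnit_det _).1
    (sqrt_mul_mul_sqrt_add_one_posDef S hJ.inv.posSemidef).isUnit
  have hJu : IsUnit J.det := (Matrix.isUnit_iff_isUnit_det _).1 hJ.isUnit
  -- The split solves the stationarity condition `J a = S b` of the infimal convolution: with `a =
  -- J⁻¹ R x` and `b = Hv - a`, the equation `Q x = R H v` says `R b = x`, so both sides equal `R
  -- x`.
  set x := Q⁻¹ *ᵥ (R *ᵥ (H *ᵥ v)) with hx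
  have hQx : R *ᵥ (J⁻¹ *ᵥ (R *ᵥ x)) + x = R *ᵥ (H *ᵥ v) := by
    have : Q *ᵥ x = R *ᵥ (H *ᵥ v) := by
      rw [hx, Matrix.mulVec_mulVec, Matrix.mul_nonsing_inv _ hQu, Matrix.one_mulVec]
    rw [← this, hQ, Matrix.add_mulVec, Matrix.one_mulVec]
    simp only [Matrix.mulVec_mulVec, Matrix.mul_assoc]
  set a := J⁻¹ *ᵥ (R *ᵥ x) with ha
  have hsym : ∀ p q : Fin m → ℝ, p ⬝ᵥ (R *ᵥ q) = (R *ᵥ p) ⬝ᵥ q := fun p q => by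
    rw [Matrix.dotProduct_mulVec, ← Matrix.mulVec_transpose, hRt]
  have hJa : J *ᵥ a = R *ᵥ x := by
    rw [ha, Matrix.mulVec_mulVec, Matrix.mul_nonsing_inv _ hJu, Matrix.one_mulVec]
  have hb : R *ᵥ (H *ᵥ v - a) = x := by
    rw [Matrix.mulVec_sub, ← hQx]; abel
  refine ⟨a, H *ᵥ v - a, by abel, ?_⟩
  have hSb : (H *ᵥ v - a) ⬝ᵥ (S *ᵥ (H *ᵥ v - a)) = x ⬝ᵥ x := by
    rw [← sqrt_mul_sqrt hS, ← hR, ← Matrix.mulVec_mulVec, hsym, hb]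
  have hinfo : v ⬝ᵥ (infoMatrix H S J *ᵥ v) = (R *ᵥ (H *ᵥ v)) ⬝ᵥ x := by
    rw [← hsym, hx]
    simp only [infoMatrix, ← hR, ← hQ, Matrix.mul_assoc Hᵀ, ← Matrix.mulVec_mulVec]
    rw [Matrix.dotProduct_mulVec, Matrix.vecMul_transpose]
  rw [hJa, hSb, hinfo, ← hQx, hsym, add_dotProduct]

end LinearAlgebra

/-! ### Scores -/

section Scores

variable {ι Z : Type*} [Fintype ι] [MeasurableSpace Z]

/-- The linear functional `v ↦ a ⬝ᵥ v`. -/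
noncomputable def dotCLM (a : ι → ℝ) : (ι → ℝ) →L[ℝ] ℝ :=
  ∑ i, a i • (ContinuousLinearMap.proj i : (ι → ℝ) →L[ℝ] ℝ)

@[simp] lemma dotCLM_apply (a v : ι → ℝ) : dotCLM a v = a ⬝ᵥ v := by
  simp [dotCLM, dotProduct]

variable [DecidableEq ι]

lemma eq_dotCLM {L : (ι → ℝ) →L[ℝ] ℝ} {a : ι → ℝ} (h : ∀ i, L (Pi.single i 1) = a i) :
    L = dotCLM a := by
  apply ContinuousLinearMap.coe_injective
  apply LinearMap.pi_ext'
  intro i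
  ext
  simp [h i]

/-- The score is prescribed only where the density is positive. Where the density vanishes at `θ`,
`θ` minimises a nonnegative function of the parameter, so the derivative vanishes too and the
identity persists `ν`-almost everywhere. -/
lemma IsScoreAt.density_mul {P : (ι → ℝ) → Measure Z} {θ : ι → ℝ} {s : Z → ι → ℝ}
    {ν : Measure Z} {p : (ι → ℝ) → Z → ℝ} (hm : Measurable (p θ)) (h0 : ∀ θ' z, 0 ≤ p θ' z)
    (hP : P θ = ν.withDensity (fun z => ENNReal.ofReal (p θ z)))
    (hd : ∀ᵐ z ∂ν, DifferentiableAt ℝ (fun θ' => p θ' z) θ)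
    (hs : ∀ᵐ z ∂(P θ), ∀ i, s z i = fderiv ℝ (fun θ' => Real.log (p θ' z)) θ (Pi.single i 1)) :
    ∀ᵐ z ∂ν, ∀ i, p θ z * s z i = fderiv ℝ (fun θ' => p θ' z) θ (Pi.single i 1) := by
  rw [hP, ae_withDensity_iff (by fun_prop)] at hs
  filter_upwards [hd, hs] with z hdz hsz i
  rcases (h0 θ z).eq_or_lt with h | h
  · have hmin : IsLocalMin (fun θ' => p θ' z) θ :=
      Filter.Eventually.of_forall fun θ' => h.symm.le.trans (h0 θ' z)
    rw [hmin.fderiv_eq_zero, ← h]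
    simp
  · rw [hsz (by simpa using h) i, fderiv.log hdz h.ne']
    simp [ne_of_gt h]

/-- A score is integrable and represents the derivative of the expectation of every bounded
measurable function. -/
lemma IsScoreAt.integrable_and_hasFDerivAt {P : (ι → ℝ) → Measure Z} {θ : ι → ℝ}
    {s : Z → ι → ℝ} (h : IsScoreAt P θ s) :
    (∀ i, Integrable (fun z => s z i) (P θ)) ∧
    ∀ φ : Z → ℝ, Measurable φ → (∃ C, ∀ z, |φ z| ≤ C) →
      HasFDerivAt (fun θ' => ∫ z, φ z ∂(P θ')) (dotCLM fun i => ∫ z, φ z * s z i ∂(P θ)) θ := by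
  obtain ⟨ν, p, hν, hp, hd, hi, hder, hs⟩ := h
  have hmul := IsScoreAt.density_mul (hp θ).1 (fun θ' => (hp θ').2.1) (hp θ).2.2 hd hs
  have hint : ∀ θ' (g : Z → ℝ), ∫ z, g z ∂(P θ') = ∫ z, p θ' z * g z ∂ν := by
    intro θ' g
    rw [(hp θ').2.2, integral_withDensity_eq_integral_toReal_smul
      (by have := (hp θ').1; fun_prop) (by simp)]
    simp [ENNReal.toReal_ofReal ((hp θ').2.1 _)]
  have hDi : ∀ i, Integrable (fun z => fderiv ℝ (fun θ' => p θ' z) θ (Pi.single i 1)) ν :=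
    fun i => hi.apply_continuousLinearMap _
  refine ⟨fun i => ?_, fun φ hφ hφb => ?_⟩
  · rw [(hp θ).2.2, integrable_withDensity_iff_integrable_smul'
      (by have := (hp θ).1; fun_prop) (by simp)]
    refine (hDi i).congr ?_
    filter_upwards [hmul] with z hz
    simp [ENNReal.toReal_ofReal ((hp θ).2.1 _), hz i]
  · have h1 := hder φ hφ hφb
    obtain ⟨C, hC⟩ := hφb
    have heq : (fun θ' => ∫ z, φ z ∂(P θ')) = fun θ' => ∫ z, φ z * p θ' z ∂ν := by
      ext θ'
      rw [hint]
      simp only [mul_comm]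
    rw [heq]
    convert h1 using 1
    symm
    apply eq_dotCLM
    intro i
    rw [ContinuousLinearMap.integral_apply]
    · rw [hint]
      apply integral_congr_ae
      filter_upwards [hmul] with z hz
      simp [← hz i]
      ring
    · exact hi.bdd_smul C hφ.aestronglyMeasurable (Filter.Eventually.of_forall hC)

lemma IsScoreAt.integrable {P : (ι → ℝ) → Measure Z} {θ : ι → ℝ}
    {s : Z → ι → ℝ} (h : IsScoreAt P θ s) (i : ι) : Integrable (fun z => s z i) (P θ) :=
  h.integrable_and_hasFDerivAt.1 i

lemma IsScoreAt.hasFDerivAt {P : (ι → ℝ) → Measure Z} {θ : ι → ℝ}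
    {s : Z → ι → ℝ} (h : IsScoreAt P θ s) {φ : Z → ℝ} (hφ : Measurable φ)
    (hb : ∃ C, ∀ z, |φ z| ≤ C) :
    HasFDerivAt (fun θ' => ∫ z, φ z ∂(P θ')) (dotCLM fun i => ∫ z, φ z * s z i ∂(P θ)) θ :=
  h.integrable_and_hasFDerivAt.2 φ hφ hb

lemma IsScoreAt.integrable_dot {P : (ι → ℝ) → Measure Z} {θ : ι → ℝ}
    {s : Z → ι → ℝ} (h : IsScoreAt P θ s) (v : ι → ℝ) :
    Integrable (fun z => s z ⬝ᵥ v) (P θ) :=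
  integrable_finsetSum _ fun i _ => (h.integrable i).mul_const _

lemma IsScoreAt.integrable_mul {P : (ι → ℝ) → Measure Z} {θ : ι → ℝ}
    {s : Z → ι → ℝ} (h : IsScoreAt P θ s) {φ : Z → ℝ} (hφ : Measurable φ)
    (hb : ∃ C, ∀ z, |φ z| ≤ C) (i : ι) : Integrable (fun z => φ z * s z i) (P θ) := by
  obtain ⟨C, hC⟩ := hb
  exact (h.integrable i).bdd_mul hφ.aestronglyMeasurable (Filter.Eventually.of_forall hC)

/-- The score functional in direction `v`. -/
lemma IsScoreAt.dotCLM_apply {P : (ι → ℝ) → Measure Z} {θ : ι → ℝ}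
    {s : Z → ι → ℝ} (h : IsScoreAt P θ s) {φ : Z → ℝ} (hφ : Measurable φ)
    (hb : ∃ C, ∀ z, |φ z| ≤ C) (v : ι → ℝ) :
    dotCLM (fun i => ∫ z, φ z * s z i ∂(P θ)) v = ∫ z, φ z * (s z ⬝ᵥ v) ∂(P θ) := by
  simp only [PPCR.dotCLM_apply, dotProduct, Finset.mul_sum]
  rw [integral_finsetSum]
  · refine Finset.sum_congr rfl fun i _ => ?_
    rw [← integral_mul_const]
    simp only [mul_assoc]
  · intro i _
    simpa only [mul_assoc] using (h.integrable_mul hφ hb i).mul_const (v i)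

/-- The test function `1` has constant expectation, and the derivative of that expectation is the
mean of the score. -/
lemma IsScoreAt.integral_eq_zero {P : (ι → ℝ) → Measure Z} (hP : ∀ θ', IsProbabilityMeasure (P θ'))
    {θ : ι → ℝ} {s : Z → ι → ℝ} (h : IsScoreAt P θ s) (i : ι) : ∫ z, s z i ∂(P θ) = 0 := by
  have h1 := h.hasFDerivAt (φ := fun _ => 1) measurable_const ⟨1, by simp⟩
  have h2 : HasFDerivAt (fun θ' => ∫ _, (1 : ℝ) ∂(P θ')) (0 : (ι → ℝ) →L[ℝ] ℝ) θ := by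
    simpa using hasFDerivAt_const (1 : ℝ) θ
  have h3 := congrArg (fun L : (ι → ℝ) →L[ℝ] ℝ => L (Pi.single i 1)) (h1.unique h2)
  simpa using h3

/-- Cauchy–Schwarz for integrals of products. -/
lemma sq_integral_mul_le {μ : Measure Z} {f g : Z → ℝ} (hf : MemLp f 2 μ) (hg : MemLp g 2 μ) :
    (∫ z, f z * g z ∂μ) ^ 2 ≤ (∫ z, f z ^ 2 ∂μ) * ∫ z, g z ^ 2 ∂μ := by
  have hf2 := hf.integrable_sq
  have hg2 := hg.integrable_sq
  have hfg : Integrable (fun z => f z * g z) μ := hf.integrable_mul hg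
  have key : ∀ t : ℝ, 0 ≤ (∫ z, g z ^ 2 ∂μ) * (t * t) + (2 * ∫ z, f z * g z ∂μ) * t +
      ∫ z, f z ^ 2 ∂μ := by
    intro t
    have : 0 ≤ ∫ z, (f z + t * g z) ^ 2 ∂μ := integral_nonneg fun z => sq_nonneg _
    have heq : ∫ z, (f z + t * g z) ^ 2 ∂μ = (∫ z, f z ^ 2 ∂μ) +
        ((2 * t) * (∫ z, f z * g z ∂μ) + (t * t) * ∫ z, g z ^ 2 ∂μ) := by
      rw [← integral_const_mul, ← integral_const_mul, ← integral_add, ← integral_add]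
      · congr 1; ext z; ring
      · exact hf2
      · exact (hfg.const_mul _).add (hg2.const_mul _)
      · exact hfg.const_mul _
      · exact hg2.const_mul _
    rw [heq] at this
    linarith
  have := discrim_le_zero key
  rw [discrim] at this
  linarith

/-- If the functional `φ ↦ E[φ g]` is bounded by `√c` in `L²` on bounded functions, then
`E[g²] ≤ c`. -/
lemma memLp_two_of_forall_bounded {μ : Measure Z} [IsFiniteMeasure μ] {g : Z → ℝ}
    (hg : AEMeasurable g μ) {c : ℝ} (hc : 0 ≤ c)
    (h : ∀ φ : Z → ℝ, Measurable φ → (∃ C, ∀ z, |φ z| ≤ C) →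
      (∫ z, φ z * g z ∂μ) ^ 2 ≤ c * ∫ z, φ z ^ 2 ∂μ) :
    MemLp g 2 μ ∧ ∫ z, g z ^ 2 ∂μ ≤ c := by
  set g' := hg.mk g with hg'
  have hg'm : Measurable g' := hg.measurable_mk
  have hgg : g =ᵐ[μ] g' := hg.ae_eq_mk
  -- Testing against the truncations of `g` itself gives `E[φ_N²]² ≤ c E[φ_N²]`, hence `E[φ_N²] ≤
  -- c`; Fatou's lemma passes to the limit.
  let φ : ℕ → Z → ℝ := fun N => {z | |g' z| ≤ N}.indicator g'
  have hS : ∀ N : ℕ, MeasurableSet {z | |g' z| ≤ N} := fun N =>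
    measurableSet_le (by fun_prop) measurable_const
  have hφm : ∀ N, Measurable (φ N) := fun N => hg'm.indicator (hS N)
  have hφb : ∀ N z, |φ N z| ≤ N := by
    intro N z
    by_cases hz : |g' z| ≤ N
    · simp [φ, hz]
    · simp [φ, hz]
  have hφ2 : ∀ N, Integrable (fun z => φ N z ^ 2) μ := fun N =>
    Integrable.of_bound ((hφm N).pow_const 2).aestronglyMeasurable ((N : ℝ) ^ 2)
      (Filter.Eventually.of_forall fun z => by
        rw [Real.norm_eq_abs, abs_pow]
        exact pow_le_pow_left₀ (abs_nonneg _) (hφb N z) 2)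
  have hle : ∀ N, ∫ z, φ N z ^ 2 ∂μ ≤ c := by
    intro N
    have h1 := h (φ N) (hφm N) ⟨N, hφb N⟩
    have h2 : ∫ z, φ N z * g z ∂μ = ∫ z, φ N z ^ 2 ∂μ := by
      apply integral_congr_ae
      filter_upwards [hgg] with z hz
      rw [hz]
      by_cases hz : |g' z| ≤ N
      · simp [φ, hz, sq]
      · simp [φ, hz]
    rw [h2] at h1
    have h3 : 0 ≤ ∫ z, φ N z ^ 2 ∂μ := integral_nonneg fun z => sq_nonneg _
    rcases h3.eq_or_lt with h4 | h4
    · rw [← h4]; exact hc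
    · rw [sq] at h1
      exact le_of_mul_le_mul_right h1 h4
  have hlim : ∀ z, Filter.Tendsto (fun N => ENNReal.ofReal (φ N z ^ 2)) Filter.atTop
      (nhds (ENNReal.ofReal (g' z ^ 2))) := by
    intro z
    obtain ⟨N₀, hN₀⟩ := exists_nat_ge |g' z|
    apply tendsto_const_nhds.congr'
    filter_upwards [Filter.eventually_ge_atTop N₀] with N hN
    have : |g' z| ≤ N := hN₀.trans (by exact_mod_cast hN)
    simp [φ, this]
  have hlint : ∫⁻ z, ENNReal.ofReal (g' z ^ 2) ∂μ ≤ ENNReal.ofReal c := by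
    calc ∫⁻ z, ENNReal.ofReal (g' z ^ 2) ∂μ
        = ∫⁻ z, Filter.liminf (fun N => ENNReal.ofReal (φ N z ^ 2)) Filter.atTop ∂μ := by
          simp only [(hlim _).liminf_eq]
      _ ≤ Filter.liminf (fun N => ∫⁻ z, ENNReal.ofReal (φ N z ^ 2) ∂μ) Filter.atTop :=
          lintegral_liminf_le fun N => by have := hφm N; fun_prop
      _ ≤ ENNReal.ofReal c := by
          apply Filter.liminf_le_of_le
          · isBoundedDefault
          · intro b hb
            obtain ⟨N, hN⟩ := hb.exists
            refine hN.trans ?_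
            rw [← ofReal_integral_eq_lintegral_ofReal (hφ2 N)
              (Filter.Eventually.of_forall fun z => sq_nonneg _)]
            exact ENNReal.ofReal_le_ofReal (hle N)
  have hi : Integrable (fun z => g' z ^ 2) μ := by
    refine ⟨(hg'm.pow_const 2).aestronglyMeasurable, ?_⟩
    rw [hasFiniteIntegral_iff_ofReal (Filter.Eventually.of_forall fun z => sq_nonneg _)]
    exact hlint.trans_lt ENNReal.ofReal_lt_top
  refine ⟨((memLp_two_iff_integrable_sq hg'm.aestronglyMeasurable).2 hi).ae_eq hgg.symm, ?_⟩
  have : ∫ z, g z ^ 2 ∂μ = ∫ z, g' z ^ 2 ∂μ :=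
    integral_congr_ae (hgg.mono fun z hz => by simp only [hz])
  rw [this, integral_eq_lintegral_of_nonneg_ae (Filter.Eventually.of_forall fun z => sq_nonneg _)
    (hg'm.pow_const 2).aestronglyMeasurable]
  exact ENNReal.toReal_le_of_le_ofReal hc hlint

end Scores

/-! ### Fisher information -/

section FisherInfo

variable {ι Z : Type*} [Fintype ι] [MeasurableSpace Z]

lemma memLp_dot {μ : Measure Z} {s : Z → ι → ℝ} (hs : ∀ i, MemLp (fun z => s z i) 2 μ)
    (v : ι → ℝ) : MemLp (fun z => s z ⬝ᵥ v) 2 μ :=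
  memLp_finsetSum _ fun i _ => (hs i).mul_const _

lemma dotProduct_mulVec_eq_integral {μ : Measure Z} {s t : Z → ι → ℝ}
    (hs : ∀ i, MemLp (fun z => s z i) 2 μ) (ht : ∀ i, MemLp (fun z => t z i) 2 μ)
    {J : Matrix ι ι ℝ} (hJ : ∀ i j, J i j = ∫ z, s z i * t z j ∂μ) (u v : ι → ℝ) :
    u ⬝ᵥ (J *ᵥ v) = ∫ z, (s z ⬝ᵥ u) * (t z ⬝ᵥ v) ∂μ := by
  have hij : ∀ i j, Integrable (fun z => s z i * t z j) μ := fun i j =>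
    (hs i).integrable_mul (ht j)
  have : ∀ z, (s z ⬝ᵥ u) * (t z ⬝ᵥ v) = ∑ i, ∑ j, u i * v j * (s z i * t z j) := by
    intro z
    simp only [dotProduct, Finset.sum_mul_sum]
    exact Finset.sum_congr rfl fun i _ => Finset.sum_congr rfl fun j _ => by ring
  simp only [this]
  rw [integral_finsetSum _ fun i _ => integrable_finsetSum _ fun j _ => (hij i j).const_mul _]
  simp only [dotProduct, Matrix.mulVec, Finset.mul_sum]
  refine Finset.sum_congr rfl fun i _ => ?_
  rw [integral_finsetSum _ fun j _ => (hij i j).const_mul _]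
  refine Finset.sum_congr rfl fun j _ => ?_
  rw [integral_const_mul, hJ i j]
  ring

lemma quadForm_eq_integral_sq {μ : Measure Z} {s : Z → ι → ℝ}
    (hs : ∀ i, MemLp (fun z => s z i) 2 μ) {J : Matrix ι ι ℝ}
    (hJ : ∀ i j, J i j = ∫ z, s z i * s z j ∂μ) (v : ι → ℝ) :
    v ⬝ᵥ (J *ᵥ v) = ∫ z, (s z ⬝ᵥ v) ^ 2 ∂μ := by
  rw [dotProduct_mulVec_eq_integral hs hs hJ]
  simp only [sq]

lemma ae_eq_zero_of_integral_sq_eq_zero {μ : Measure Z} {g : Z → ℝ} (hg : MemLp g 2 μ)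
    (h : ∫ z, g z ^ 2 ∂μ = 0) : ∀ᵐ z ∂μ, g z = 0 := by
  have := (integral_eq_zero_iff_of_nonneg (fun z => sq_nonneg (g z)) hg.integrable_sq).1 h
  filter_upwards [this] with z hz
  simpa using hz

variable [DecidableEq ι]

/-- A model with zero Fisher information at every parameter is constant. -/
lemma eq_of_hasFisherInfo_zero {P : (ι → ℝ) → Measure Z} (hP : ∀ θ, IsProbabilityMeasure (P θ))
    (h : ∀ θ, HasFisherInfo P θ 0) (θ₁ θ₂ : ι → ℝ) : P θ₁ = P θ₂ := by
  ext A hA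
  -- The score vanishes almost surely, so the probability of each event has zero derivative at every
  -- parameter.
  have hd : ∀ θ, HasFDerivAt (fun θ' => ∫ z, A.indicator 1 z ∂(P θ'))
      (0 : (ι → ℝ) →L[ℝ] ℝ) θ := by
    intro θ
    obtain ⟨s, hs, hL, hJ⟩ := h θ
    have h1 := hs.hasFDerivAt (φ := A.indicator 1) (measurable_one.indicator hA)
      ⟨1, fun z => by by_cases hz : z ∈ A <;> simp [hz]⟩
    have h2 : ∀ i, ∫ z, A.indicator 1 z * s z i ∂(P θ) = 0 := by
      intro i
      have h0 : ∀ᵐ z ∂(P θ), s z i = 0 :=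
        ae_eq_zero_of_integral_sq_eq_zero (hL i) (by simpa [sq] using (hJ i i).symm)
      refine integral_eq_zero_of_ae ?_
      filter_upwards [h0] with z hz
      simp [hz]
    convert h1 using 1
    symm
    ext v
    simp [h2, dotProduct]
  have hc := is_const_of_fderiv_eq_zero (𝕜 := ℝ) (fun θ => (hd θ).differentiableAt)
    (fun θ => (hd θ).fderiv) θ₁ θ₂
  simp only [integral_indicator_one hA] at hc
  exact (measureReal_eq_measureReal_iff).1 hc

/-- Cauchy–Schwarz against a centred variable. -/
lemma sq_integral_mul_le_variance_mul {μ : Measure Z} [IsProbabilityMeasure μ] {f g : Z → ℝ}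
    (hf : MemLp f 2 μ) (hg : MemLp g 2 μ) (hg0 : ∫ z, g z ∂μ = 0) :
    (∫ z, f z * g z ∂μ) ^ 2 ≤
      ((∫ z, f z ^ 2 ∂μ) - (∫ z, f z ∂μ) ^ 2) * ∫ z, g z ^ 2 ∂μ := by
  set c := ∫ z, f z ∂μ with hc
  have hfi : Integrable f μ := hf.integrable one_le_two
  have hgi : Integrable g μ := hg.integrable one_le_two
  have hfg : Integrable (fun z => f z * g z) μ := hf.integrable_mul hg
  have h1 : (∫ z, (f z - c) * g z ∂μ) ^ 2 ≤ (∫ z, (f z - c) ^ 2 ∂μ) * ∫ z, g z ^ 2 ∂μ :=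
    sq_integral_mul_le (hf.sub (memLp_const c)) hg
  have h2 : ∫ z, (f z - c) * g z ∂μ = ∫ z, f z * g z ∂μ := by
    simp only [sub_mul]
    rw [integral_sub hfg (hgi.const_mul c), integral_const_mul, hg0]
    simp
  have h3 : ∫ z, (f z - c) ^ 2 ∂μ = (∫ z, f z ^ 2 ∂μ) - c ^ 2 := by
    have : ∀ z, (f z - c) ^ 2 = f z ^ 2 - (2 * c) * f z + c ^ 2 := fun z => by ring
    have hi : Integrable (fun z => f z ^ 2 - (2 * c) * f z) μ :=
      hf.integrable_sq.sub (hfi.const_mul _)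
    simp only [this]
    rw [integral_add hi (integrable_const _), integral_sub hf.integrable_sq (hfi.const_mul _),
      integral_const_mul, ← hc]
    simp
    ring
  rwa [h2, h3] at h1

lemma memLp_two_of_bounded {μ : Measure Z} [IsFiniteMeasure μ] {φ : Z → ℝ} (hφ : Measurable φ)
    (hb : ∃ C, ∀ z, |φ z| ≤ C) : MemLp φ 2 μ := by
  obtain ⟨C, hC⟩ := hb
  exact MemLp.of_bound hφ.aestronglyMeasurable C (Filter.Eventually.of_forall hC)

/-- The derivative of an expectation is controlled by the Fisher information and the variance. -/
lemma HasFisherInfo.exists_hasFDerivAt {P : (ι → ℝ) → Measure Z}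
    (hP : ∀ θ, IsProbabilityMeasure (P θ)) {θ : ι → ℝ} {J : Matrix ι ι ℝ}
    (h : HasFisherInfo P θ J) {φ : Z → ℝ} (hφ : Measurable φ) (hb : ∃ C, ∀ z, |φ z| ≤ C) :
    ∃ L : (ι → ℝ) →L[ℝ] ℝ, HasFDerivAt (fun θ' => ∫ z, φ z ∂(P θ')) L θ ∧
      ∀ v, (L v) ^ 2 ≤ ((∫ z, φ z ^ 2 ∂(P θ)) - (∫ z, φ z ∂(P θ)) ^ 2) * (v ⬝ᵥ (J *ᵥ v)) := by
  obtain ⟨s, hs, hL, hJ⟩ := h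
  refine ⟨_, hs.hasFDerivAt hφ hb, fun v => ?_⟩
  rw [hs.dotCLM_apply hφ hb, quadForm_eq_integral_sq hL hJ]
  refine sq_integral_mul_le_variance_mul (memLp_two_of_bounded hφ hb) (memLp_dot hL v) ?_
  simp only [dotProduct]
  rw [integral_finsetSum _ fun i _ => (hs.integrable i).mul_const _]
  simp [integral_mul_const, hs.integral_eq_zero hP]

lemma HasFisherInfo.isSymm {P : (ι → ℝ) → Measure Z} {θ : ι → ℝ} {J : Matrix ι ι ℝ}
    (h : HasFisherInfo P θ J) : J.IsSymm := by
  obtain ⟨s, -, -, hJ⟩ := h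
  ext i j
  rw [Matrix.transpose_apply, hJ, hJ]
  simp only [mul_comm]

end FisherInfo

/-! ### Location families -/

section Location

variable {m : ℕ}

instance (μ : Measure (Fin m → ℝ)) [IsProbabilityMeasure μ] (η : Fin m → ℝ) :
    IsProbabilityMeasure (locationFamily μ η) :=
  Measure.isProbabilityMeasure_map (by fun_prop)

lemma integral_locationFamily (μ : Measure (Fin m → ℝ)) (η : Fin m → ℝ)
    {φ : (Fin m → ℝ) → ℝ} (hφ : Measurable φ) :
    ∫ x, φ x ∂(locationFamily μ η) = ∫ w, φ (η + w) ∂μ :=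
  integral_map (by fun_prop) hφ.aestronglyMeasurable

/-- The Fisher information of a location family is positive definite. -/
lemma HasFisherInfo.posDef_of_locationFamily {μ : Measure (Fin m → ℝ)} [IsProbabilityMeasure μ]
    {η : Fin m → ℝ} {J : Matrix (Fin m) (Fin m) ℝ} (h : HasFisherInfo (locationFamily μ) η J) :
    J.PosDef := by
  have hsymm := h.isSymm
  obtain ⟨s, hs, hL, hJ⟩ := id h
  rw [Matrix.posDef_iff_dotProduct_mulVec]
  refine ⟨by rwa [Matrix.IsHermitian, Matrix.conjTranspose_eq_transpose_of_trivial], ?_⟩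
  intro v hv
  rw [star_trivial]
  have hq := quadForm_eq_integral_sq hL hJ v
  have h0 : 0 ≤ v ⬝ᵥ (J *ᵥ v) := hq ▸ integral_nonneg fun z => sq_nonneg _
  refine h0.lt_of_ne fun hzero => ?_
  -- the expectation of a bounded function does not change along `v`
  have hd : ∀ φ : (Fin m → ℝ) → ℝ, Measurable φ → (∃ C, ∀ z, |φ z| ≤ C) →
      HasDerivAt (fun t : ℝ => ∫ w, φ (η + t • v + w) ∂μ) 0 0 := by
    intro φ hφ hb
    obtain ⟨L, hL1, hL2⟩ := h.exists_hasFDerivAt (fun _ => inferInstance) hφ hb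
    have hLv : L v = 0 := by
      have := hL2 v
      rw [← hzero, mul_zero] at this
      exact pow_eq_zero_iff two_ne_zero |>.1 (le_antisymm this (sq_nonneg _))
    have hc : HasDerivAt (fun t : ℝ => η + t • v) v 0 := by
      simpa using ((hasDerivAt_id (0 : ℝ)).smul_const v).const_add η
    have hL1' : HasFDerivAt (fun η' => ∫ w, φ (η' + w) ∂μ) L (η + (0 : ℝ) • v) := by
      simpa only [zero_smul, add_zero, integral_locationFamily μ _ hφ] using hL1
    have := hL1'.comp_hasDerivAt 0 hc
    rw [hLv] at this
    exact this
  -- A bounded increasing function of `v ⬝ᵥ x`: its expectation must tend to `±π/2` as the location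
  -- moves to infinity along `±v`, which is incompatible with being constant.
  let φ : (Fin m → ℝ) → ℝ := fun x => Real.arctan (v ⬝ᵥ x)
  have hφc : Continuous φ := Real.continuous_arctan.comp (by fun_prop)
  have hφb : ∀ z, |φ z| ≤ Real.pi / 2 := fun z =>
    abs_le.2 ⟨(Real.neg_pi_div_two_lt_arctan _).le, (Real.arctan_lt_pi_div_two _).le⟩
  let F : ℝ → ℝ := fun t => ∫ w, φ (η + t • v + w) ∂μ
  have hF : ∀ t, HasDerivAt F 0 t := by
    intro t
    -- Information is available only at `η`. In a location family, translating the test function by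
    -- `t • v` carries the vanishing derivative from `0` to any `t`.
    have h1 := hd (fun x => φ (t • v + x)) (hφc.comp (by fun_prop)).measurable
      ⟨Real.pi / 2, fun z => hφb _⟩
    have hcomp : F = (fun r : ℝ => ∫ w, φ (t • v + (η + r • v + w)) ∂μ) ∘ fun r => r - t := by
      ext r
      refine integral_congr_ae (Filter.Eventually.of_forall fun w => congrArg φ ?_)
      module
    rw [hcomp]
    have h2 : HasDerivAt (fun r : ℝ => r - t) 1 t := (hasDerivAt_id t).sub_const t
    simpa only [zero_mul] using HasDerivAt.comp t (h₂' := 0) (by rwa [sub_self]) h2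
  have hconst : ∀ t, F t = F 0 := fun t =>
    is_const_of_deriv_eq_zero (fun t => (hF t).differentiableAt) (fun t => (hF t).deriv) t 0
  have hvv : 0 < v ⬝ᵥ v := by
    have := Matrix.dotProduct_star_self_pos_iff.2 hv
    rwa [star_trivial] at this
  have hexp : ∀ (t : ℝ) w, φ (η + t • v + w) = Real.arctan (t * (v ⬝ᵥ v) + v ⬝ᵥ (η + w)) := by
    intro t w
    simp only [φ, dotProduct_add, dotProduct_smul, smul_eq_mul]
    ring_nf
  have hT : Filter.Tendsto F Filter.atTop (nhds (∫ _, Real.pi / 2 ∂μ)) := by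
    refine tendsto_integral_filter_of_dominated_convergence (fun _ => Real.pi / 2)
      (Filter.Eventually.of_forall fun t => Continuous.aestronglyMeasurable (by fun_prop))
      (Filter.Eventually.of_forall fun t => Filter.Eventually.of_forall fun w => hφb _)
      (integrable_const _) (Filter.Eventually.of_forall fun w => ?_)
    simp only [hexp]
    exact (Real.tendsto_arctan_atTop.mono_right nhdsWithin_le_nhds).comp
      (Filter.tendsto_atTop_add_const_right _ _ (Filter.tendsto_id.atTop_mul_const hvv))
  have hB : Filter.Tendsto F Filter.atBot (nhds (∫ _, -(Real.pi / 2) ∂μ)) := by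
    refine tendsto_integral_filter_of_dominated_convergence (fun _ => Real.pi / 2)
      (Filter.Eventually.of_forall fun t => Continuous.aestronglyMeasurable (by fun_prop))
      (Filter.Eventually.of_forall fun t => Filter.Eventually.of_forall fun w => hφb _)
      (integrable_const _) (Filter.Eventually.of_forall fun w => ?_)
    simp only [hexp]
    exact (Real.tendsto_arctan_atBot.mono_right nhdsWithin_le_nhds).comp
      (Filter.tendsto_atBot_add_const_right _ _ (Filter.tendsto_id.atBot_mul_const hvv))
  have e1 := tendsto_nhds_unique (hT.congr hconst) tendsto_const_nhds
  have e2 := tendsto_nhds_unique (hB.congr hconst) tendsto_const_nhds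
  have e3 := e1.trans e2.symm
  simp only [integral_const, probReal_univ, one_smul] at e3
  linarith [Real.pi_pos]

/-- Differentiation of `η ↦ E[ψ(η + w)]` inside the expectation. -/
lemma hasFDerivAt_integral_add_apply {μ : Measure (Fin m → ℝ)} [IsProbabilityMeasure μ]
    {ψ : (Fin m → ℝ) → ℝ} (hψ : Measurable ψ) {C C' : ℝ} (hC : ∀ y, |ψ y| ≤ C)
    (hd : Differentiable ℝ ψ) (b : Fin m → ℝ) (hC' : ∀ y, |fderiv ℝ ψ y b| ≤ C')
    {η : Fin m → ℝ} {L : (Fin m → ℝ) →L[ℝ] ℝ}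
    (hL : HasFDerivAt (fun η' => ∫ w, ψ (η' + w) ∂μ) L η) :
    L b = ∫ w, fderiv ℝ ψ (η + w) b ∂μ := by
  have hc : HasDerivAt (fun t : ℝ => η + t • b) b 0 := by
    simpa using ((hasDerivAt_id (0 : ℝ)).smul_const b).const_add η
  have hL' : HasFDerivAt (fun η' => ∫ w, ψ (η' + w) ∂μ) L (η + (0 : ℝ) • b) := by
    simpa only [zero_smul, add_zero] using hL
  -- `L b` is the derivative at `0` of `t ↦ E[ψ(η + t b + w)]`; `h2` computes it again under the
  -- integral sign, with the constant `C'` as dominating function.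
  have h1 := hL'.comp_hasDerivAt (0 : ℝ) hc
  have h2 := (hasDerivAt_integral_of_dominated_loc_of_deriv_le (μ := μ) (𝕜 := ℝ)
    (F := fun (t : ℝ) w => ψ (η + t • b + w)) (F' := fun t w => fderiv ℝ ψ (η + t • b + w) b)
    (x₀ := 0) (s := Set.univ) (bound := fun _ => C') Filter.univ_mem
    (Filter.Eventually.of_forall fun t => Measurable.aestronglyMeasurable (by fun_prop))
    (Integrable.of_bound (Measurable.aestronglyMeasurable (by fun_prop)) C
      (Filter.Eventually.of_forall fun w => hC _))
    (Measurable.aestronglyMeasurable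
      ((measurable_fderiv_apply_const ℝ ψ b).comp (by fun_prop)))
    (Filter.Eventually.of_forall fun w t _ => hC' _)
    (integrable_const _)
    (Filter.Eventually.of_forall fun w t _ => ?_)).2
  · simpa using h1.unique h2
  · have hc' : HasDerivAt (fun t : ℝ => η + t • b + w) b t := by
      simpa using (((hasDerivAt_id t).smul_const b).const_add η).add_const w
    exact (hd _).hasFDerivAt.comp_hasDerivAt t hc'

/-- Cauchy–Schwarz in the plane for `(√α, √β)` and `(√V, √U)`. It merges the bounds along `a` and
`b` so that informations and variances add separately. -/
lemma add_sq_le_of_sq_le {x y α β V U : ℝ} (hα : 0 ≤ α) (hβ : 0 ≤ β) (hV : 0 ≤ V) (hU : 0 ≤ U)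
    (hx : x ^ 2 ≤ V * α) (hy : y ^ 2 ≤ U * β) : (x + y) ^ 2 ≤ (α + β) * (V + U) := by
  have h1 : |x| ≤ √V * √α := by
    rw [← Real.sqrt_mul hV]; exact Real.abs_le_sqrt hx
  have h2 : |y| ≤ √U * √β := by
    rw [← Real.sqrt_mul hU]; exact Real.abs_le_sqrt hy
  have h3 : |x + y| ≤ √V * √α + √U * √β := (abs_add_le _ _).trans (add_le_add h1 h2)
  have h4 : (x + y) ^ 2 ≤ (√V * √α + √U * √β) ^ 2 := by
    rw [← sq_abs]; exact pow_le_pow_left₀ (abs_nonneg _) h3 2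
  refine h4.trans ?_
  have e1 := Real.sq_sqrt hα
  have e2 := Real.sq_sqrt hβ
  have e3 := Real.sq_sqrt hV
  have e4 := Real.sq_sqrt hU
  have key : (√V * √α + √U * √β) ^ 2 ≤ (√α ^ 2 + √β ^ 2) * (√V ^ 2 + √U ^ 2) := by
    nlinarith [sq_nonneg (√V * √β - √U * √α)]
  rwa [e1, e2, e3, e4] at key

/-- The Fisher information of `z` about a location parameter of `y`, in terms of the information
of `y` and a bound `S` on the information of `z` about `y`. -/
lemma sq_hasFDerivAt_kernel_le {Z : Type*} [MeasurableSpace Z] {μ : Measure (Fin m → ℝ)}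
    [IsProbabilityMeasure μ] {η : Fin m → ℝ} {J S : Matrix (Fin m) (Fin m) ℝ}
    (hS : S.PosSemidef) (hJ : HasFisherInfo (locationFamily μ) η J)
    {K : (Fin m → ℝ) → Measure Z} (hK : ∀ y, IsProbabilityMeasure (K y))
    (hKS : ∀ y, ∃ I : Matrix (Fin m) (Fin m) ℝ, HasFisherInfo K y I ∧ I ≤ S)
    (hKm : ∀ φ : Z → ℝ, Measurable φ → Measurable fun y => ∫ z, φ z ∂(K y))
    {φ : Z → ℝ} (hφ : Measurable φ) (hb : ∃ C, ∀ z, |φ z| ≤ C)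
    {L : (Fin m → ℝ) →L[ℝ] ℝ}
    (hL : HasFDerivAt (fun η' => ∫ w, ∫ z, φ z ∂(K (η' + w)) ∂μ) L η) (a b : Fin m → ℝ) :
    (L (a + b)) ^ 2 ≤ (a ⬝ᵥ (J *ᵥ a) + b ⬝ᵥ (S *ᵥ b)) *
      ∫ w, ∫ z, φ z ^ 2 ∂(K (η + w)) ∂μ := by
  obtain ⟨C, hC⟩ := id hb
  -- `ψ` and `χ` are the conditional first and second moments of `φ(z)` given `y`, so `χ - ψ²` is
  -- the conditional variance.
  set ψ : (Fin m → ℝ) → ℝ := fun y => ∫ z, φ z ∂(K y) with hψdef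
  set χ : (Fin m → ℝ) → ℝ := fun y => ∫ z, φ z ^ 2 ∂(K y) with hχdef
  have hψm : Measurable ψ := hKm φ hφ
  have hχm : Measurable χ := hKm _ (hφ.pow_const 2)
  have hψC : ∀ y, |ψ y| ≤ C := by
    intro y
    have := norm_integral_le_of_norm_le_const (μ := K y) (f := φ)
      (Filter.Eventually.of_forall hC)
    simpa using this
  have hφ2 : ∀ z, |φ z ^ 2| ≤ C ^ 2 := fun z => by
    rw [abs_pow]; exact pow_le_pow_left₀ (abs_nonneg _) (hC z) 2
  have hχC : ∀ y, |χ y| ≤ C ^ 2 := by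
    intro y
    have := norm_integral_le_of_norm_le_const (μ := K y) (f := fun z => φ z ^ 2)
      (Filter.Eventually.of_forall hφ2)
    simpa using this
  have hψ2C : ∀ y, |ψ y ^ 2| ≤ C ^ 2 := fun z => by
    rw [abs_pow]; exact pow_le_pow_left₀ (abs_nonneg _) (hψC z) 2
  have hbS : 0 ≤ b ⬝ᵥ (S *ᵥ b) := by simpa using hS.dotProduct_mulVec_nonneg b
  have haJ : 0 ≤ a ⬝ᵥ (J *ᵥ a) := by
    simpa using hJ.posDef_of_locationFamily.posSemidef.dotProduct_mulVec_nonneg a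
  have hvar : ∀ y, 0 ≤ χ y - ψ y ^ 2 := by
    intro y
    have := sq_integral_mul_le (μ := K y) (memLp_two_of_bounded hφ hb)
      (memLp_const (1 : ℝ))
    simp only [mul_one, one_pow, integral_const, probReal_univ, smul_eq_mul] at this
    simpa [hψdef, hχdef] using this
  -- The privacy constraint at every single `y` makes `ψ` differentiable everywhere, with slope
  -- along `b` bounded by the conditional variance times `bᵀSb`.
  have hgrad : ∀ y, DifferentiableAt ℝ ψ y ∧
      (fderiv ℝ ψ y b) ^ 2 ≤ (χ y - ψ y ^ 2) * (b ⬝ᵥ (S *ᵥ b)) := by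
    intro y
    obtain ⟨I, hI, hIS⟩ := hKS y
    obtain ⟨L', hL1, hL2⟩ := hI.exists_hasFDerivAt hK hφ hb
    refine ⟨hL1.differentiableAt, ?_⟩
    rw [hL1.fderiv]
    refine (hL2 b).trans (mul_le_mul_of_nonneg_left ?_ (hvar y))
    have := (Matrix.le_iff.1 hIS).dotProduct_mulVec_nonneg b
    simpa [Matrix.sub_mulVec, dotProduct_sub] using this
  have hD : ∀ y, |fderiv ℝ ψ y b| ≤ √(C ^ 2 * (b ⬝ᵥ (S *ᵥ b))) := by
    intro y
    refine Real.abs_le_sqrt ((hgrad y).2.trans (mul_le_mul_of_nonneg_right ?_ hbS))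
    have := (abs_le.1 (hχC y)).2
    nlinarith [sq_nonneg (ψ y)]
  have hLb := hasFDerivAt_integral_add_apply hψm hψC (fun y => (hgrad y).1) b hD hL
  have hDm : Measurable fun w => fderiv ℝ ψ (η + w) b :=
    (measurable_fderiv_apply_const ℝ ψ b).comp (by fun_prop)
  have hint : ∀ {f : (Fin m → ℝ) → ℝ} {c : ℝ}, Measurable f → (∀ y, |f y| ≤ c) →
      Integrable (fun w => f (η + w)) μ := fun hf hc =>
    Integrable.of_bound (hf.comp (by fun_prop)).aestronglyMeasurable _
      (Filter.Eventually.of_forall fun w => hc _)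
  have hχi := hint hχm hχC
  have hψ2i := hint (hψm.pow_const 2) hψ2C
  -- Moving `y` inside the kernel: Jensen and the pointwise slope bound leave the mean conditional
  -- variance.
  have hb2 : (L b) ^ 2 ≤ (∫ w, (χ (η + w) - ψ (η + w) ^ 2) ∂μ) * (b ⬝ᵥ (S *ᵥ b)) := by
    have hDL : MemLp (fun w => fderiv ℝ ψ (η + w) b) 2 μ :=
      memLp_two_of_bounded hDm ⟨_, fun w => hD _⟩
    have h1 := sq_integral_mul_le hDL (memLp_const (1 : ℝ))
    simp only [mul_one, one_pow, integral_const, probReal_univ, smul_eq_mul] at h1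
    rw [hLb, ← integral_mul_const]
    refine h1.trans (integral_mono hDL.integrable_sq ((hχi.sub hψ2i).mul_const _) fun w => ?_)
    exact (hgrad _).2
  -- Moving the law of `y` instead, with `ψ` as a fixed test function: this leaves the variance of
  -- the conditional mean.
  have ha2 : (L a) ^ 2 ≤ ((∫ w, ψ (η + w) ^ 2 ∂μ) - (∫ w, ψ (η + w) ∂μ) ^ 2) *
      (a ⬝ᵥ (J *ᵥ a)) := by
    obtain ⟨L', hL1, hL2⟩ := hJ.exists_hasFDerivAt (fun _ => inferInstance) hψm ⟨C, hψC⟩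
    simp only [integral_locationFamily μ _ hψm,
      integral_locationFamily μ _ (hψm.pow_const 2)] at hL1 hL2
    rw [hL.unique hL1]
    exact hL2 a
  rw [integral_sub hχi hψ2i] at hb2
  rw [map_add]
  have hV : 0 ≤ (∫ w, ψ (η + w) ^ 2 ∂μ) - (∫ w, ψ (η + w) ∂μ) ^ 2 := by
    have hψL : MemLp (fun w => ψ (η + w)) 2 μ :=
      memLp_two_of_bounded (hψm.comp (by fun_prop)) ⟨C, fun w => hψC _⟩
    have := sq_integral_mul_le hψL (memLp_const (1 : ℝ))
    simp only [mul_one, one_pow, integral_const, probReal_univ, smul_eq_mul] at this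
    linarith
  have hU : 0 ≤ (∫ w, χ (η + w) ∂μ) - ∫ w, ψ (η + w) ^ 2 ∂μ := by
    rw [← integral_sub hχi hψ2i]
    exact integral_nonneg fun w => hvar _
  -- By total variance, the two factors sum to `E[φ²] - (E φ)²`, which is at most `E[φ²]`.
  refine (add_sq_le_of_sq_le haJ hbS hV hU ha2 hb2).trans
    (mul_le_mul_of_nonneg_left ?_ (add_nonneg haJ hbS))
  nlinarith [sq_nonneg (∫ w, ψ (η + w) ∂μ)]

end Location

/-! ### The information bound for private mechanisms -/

namespace Mechanism

variable {m n k q : ℕ} (A : Mechanism m k q)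

instance isProbabilityMeasure_noise : IsProbabilityMeasure A.noise := by
  have hi : Integrable A.f volume := by
    by_contra h
    have := A.integral_f
    rw [integral_undef h] at this
    exact zero_ne_one this
  refine ⟨?_⟩
  rw [noise, withDensity_apply _ MeasurableSet.univ, Measure.restrict_univ,
    ← ofReal_integral_eq_lintegral_ofReal hi (Filter.Eventually.of_forall A.f_nonneg),
    A.integral_f, ENNReal.ofReal_one]

lemma measurable_M_apply (y : Fin m → ℝ) : Measurable (A.M y) :=
  A.measurable_M.comp measurable_prodMk_left

lemma measurable_output (H : Matrix (Fin m) (Fin n) ℝ) (θ : Fin n → ℝ) :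
    Measurable fun x : (Fin m → ℝ) × (Fin k → ℝ) => A.M (H *ᵥ θ + x.1) x.2 :=
  A.measurable_M.comp
    ((measurable_const.add measurable_fst).prodMk measurable_snd)

instance isProbabilityMeasure_lawGivenY (y : Fin m → ℝ) :
    IsProbabilityMeasure (A.lawGivenY y) :=
  Measure.isProbabilityMeasure_map (A.measurable_M_apply y).aemeasurable

lemma isProbabilityMeasure_lawGivenθ (H : Matrix (Fin m) (Fin n) ℝ)
    {W : (Fin n → ℝ) → Measure (Fin m → ℝ)} (hW : ∀ θ, IsProbabilityMeasure (W θ))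
    (θ : Fin n → ℝ) : IsProbabilityMeasure (A.lawGivenθ H W θ) :=
  Measure.isProbabilityMeasure_map (A.measurable_output H θ).aemeasurable

lemma integral_lawGivenY {φ : (Fin q → ℝ) → ℝ} (hφ : Measurable φ) (y : Fin m → ℝ) :
    ∫ z, φ z ∂(A.lawGivenY y) = ∫ d, φ (A.M y d) ∂A.noise :=
  integral_map (A.measurable_M_apply y).aemeasurable hφ.aestronglyMeasurable

lemma measurable_integral_lawGivenY {φ : (Fin q → ℝ) → ℝ} (hφ : Measurable φ) :
    Measurable fun y => ∫ z, φ z ∂(A.lawGivenY y) := by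
  simp only [A.integral_lawGivenY hφ]
  exact (StronglyMeasurable.integral_prod_right (ν := A.noise) (f := fun y d => φ (A.M y d))
    (hφ.comp A.measurable_M).stronglyMeasurable).measurable

lemma integral_lawGivenθ (H : Matrix (Fin m) (Fin n) ℝ)
    {W : (Fin n → ℝ) → Measure (Fin m → ℝ)} (hW : ∀ θ, IsProbabilityMeasure (W θ))
    (θ : Fin n → ℝ) {φ : (Fin q → ℝ) → ℝ} (hφ : Measurable φ) (hb : ∃ C, ∀ z, |φ z| ≤ C) :
    ∫ z, φ z ∂(A.lawGivenθ H W θ) = ∫ w, ∫ z, φ z ∂(A.lawGivenY (H *ᵥ θ + w)) ∂(W θ) := by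
  obtain ⟨C, hC⟩ := hb
  rw [lawGivenθ, integral_map (A.measurable_output H θ).aemeasurable hφ.aestronglyMeasurable,
    integral_prod]
  · simp only [A.integral_lawGivenY hφ]
  · exact Integrable.of_bound (hφ.comp (A.measurable_output H θ)).aestronglyMeasurable C
      (Filter.Eventually.of_forall fun x => hC _)

/-- The score of the output of a private mechanism is square integrable, and its information is
bounded by `infoMatrix H S J`. -/
lemma Private.score_sq_le {A : Mechanism m k q} {H : Matrix (Fin m) (Fin n) ℝ}
    {W : (Fin n → ℝ) → Measure (Fin m → ℝ)} (hW : ∀ θ, IsProbabilityMeasure (W θ))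
    (hW0 : ∀ θ, HasFisherInfo W θ 0) {θ : Fin n → ℝ} {S J : Matrix (Fin m) (Fin m) ℝ}
    (hS : S.PosSemidef) (hJ : HasFisherInfo (locationFamily (W θ)) (H *ᵥ θ) J)
    (hA : A.Private S) {s : (Fin q → ℝ) → Fin n → ℝ} (hs : IsScoreAt (A.lawGivenθ H W) θ s)
    (v : Fin n → ℝ) :
    MemLp (fun z => s z ⬝ᵥ v) 2 (A.lawGivenθ H W θ) ∧
      ∫ z, (s z ⬝ᵥ v) ^ 2 ∂(A.lawGivenθ H W θ) ≤ v ⬝ᵥ (infoMatrix H S J *ᵥ v) := by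
  have := A.isProbabilityMeasure_lawGivenθ H hW θ
  have hJpd := hJ.posDef_of_locationFamily
  obtain ⟨a, b, hab, habq⟩ := exists_add_eq_infoMatrix H hS hJpd v
  have hc : 0 ≤ v ⬝ᵥ (infoMatrix H S J *ᵥ v) := by
    rw [← habq]
    refine add_nonneg ?_ ?_
    · simpa using hJpd.posSemidef.dotProduct_mulVec_nonneg a
    · simpa using hS.dotProduct_mulVec_nonneg b
  -- The score is known only to be integrable; its square integrability and the bound both come from
  -- testing against bounded functions.
  refine memLp_two_of_forall_bounded (hs.integrable_dot v).aemeasurable hc fun φ hφ hb => ?_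
  obtain ⟨C, hC⟩ := id hb
  have hφ2b : ∃ C, ∀ z, |φ z ^ 2| ≤ C := ⟨C ^ 2, fun z => by
    rw [abs_pow]; exact pow_le_pow_left₀ (abs_nonneg _) (hC z) 2⟩
  have hψm := A.measurable_integral_lawGivenY hφ
  have hψb : ∃ C, ∀ y, |∫ z, φ z ∂(A.lawGivenY y)| ≤ C := ⟨C, fun y => by
    simpa using norm_integral_le_of_norm_le_const (μ := A.lawGivenY y) (f := φ)
      (Filter.Eventually.of_forall hC)⟩
  -- Differentiability of `F` at `Hθ` is supplied by the location family of `w`, with the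
  -- conditional mean as test function.
  obtain ⟨L, hL, -⟩ := hJ.exists_hasFDerivAt (fun _ => inferInstance) hψm hψb
  simp only [integral_locationFamily _ _ hψm] at hL
  have hmain := sq_hasFDerivAt_kernel_le hS hJ (K := A.lawGivenY) (fun _ => inferInstance) hA
    (fun φ hφ => A.measurable_integral_lawGivenY hφ) hφ hb hL a b
  rw [hab, habq, ← A.integral_lawGivenθ H hW θ (hφ.pow_const 2) hφ2b] at hmain
  have hlin : HasFDerivAt (fun θ' : Fin n → ℝ => H *ᵥ θ')
      (LinearMap.toContinuousLinearMap H.mulVecLin) θ :=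
    (LinearMap.toContinuousLinearMap H.mulVecLin).hasFDerivAt
  have h1 := HasFDerivAt.comp θ hL hlin
  have h2 := hs.hasFDerivAt hφ hb
  -- Here the constancy of the noise law enters: `θ'` affects the output only through `H *ᵥ θ'`.
  have heq : (fun θ' => ∫ z, φ z ∂(A.lawGivenθ H W θ')) =
      (fun η' => ∫ w, ∫ z, φ z ∂(A.lawGivenY (η' + w)) ∂(W θ)) ∘ fun θ' => H *ᵥ θ' := by
    ext θ'
    rw [A.integral_lawGivenθ H hW θ' hφ hb, eq_of_hasFisherInfo_zero hW hW0 θ' θ]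
    rfl
  rw [heq] at h2
  have h3 := congrArg (fun L : (Fin n → ℝ) →L[ℝ] ℝ => L v) (h2.unique h1)
  simp only [hs.dotCLM_apply hφ hb] at h3
  rw [h3]
  exact hmain

end Mechanism

/-! ### The Cramér–Rao inequality -/

/-- The Cramér–Rao inequality, for a score whose information is bounded by `K`. -/
lemma errorCovGE_inv_of_score_sq_le {n : ℕ} {Z : Type*} [MeasurableSpace Z]
    {P : (Fin n → ℝ) → Measure Z} (hP : ∀ θ, IsProbabilityMeasure (P θ)) {θ : Fin n → ℝ}
    {T : Z → Fin n → ℝ} (hT : IsUnbiased P T) (hreg : IsRegularEstimatorAt P T θ)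
    {K : Matrix (Fin n) (Fin n) ℝ} (hK : K.PosDef)
    (hinfo : ∀ s, IsScoreAt P θ s → ∀ v, MemLp (fun z => s z ⬝ᵥ v) 2 (P θ) ∧
      ∫ z, (s z ⬝ᵥ v) ^ 2 ∂(P θ) ≤ v ⬝ᵥ (K *ᵥ v)) :
    ErrorCovGE P T θ K⁻¹ := by
  intro u
  obtain ⟨s, hs, hTs, hder⟩ := hreg
  have hKu : IsUnit K.det := (Matrix.isUnit_iff_isUnit_det _).1 hK.isUnit
  -- In this direction both the correlation `E[(uᵀ(T - θ))(sᵀv)]` and the bound `vᵀKv` on the score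
  -- equal `uᵀK⁻¹u`, so one factor cancels in Cauchy–Schwarz.
  set v := K⁻¹ *ᵥ u with hv
  have hKv : K *ᵥ v = u := by
    rw [hv, Matrix.mulVec_mulVec, Matrix.mul_nonsing_inv _ hKu, Matrix.one_mulVec]
  have huv : 0 ≤ u ⬝ᵥ v := by simpa using hK.inv.posSemidef.dotProduct_mulVec_nonneg u
  have hgm : Measurable fun z => u ⬝ᵥ (T z - θ) := by
    have := hT.1
    simp only [dotProduct]
    fun_prop
  by_cases htop : ∫⁻ z, ENNReal.ofReal ((u ⬝ᵥ (T z - θ)) ^ 2) ∂(P θ) = ⊤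
  · rw [htop]; exact le_top
  have hgi : Integrable (fun z => (u ⬝ᵥ (T z - θ)) ^ 2) (P θ) := by
    refine ⟨(hgm.pow_const 2).aestronglyMeasurable, ?_⟩
    rw [hasFiniteIntegral_iff_ofReal (Filter.Eventually.of_forall fun z => sq_nonneg _)]
    exact lt_top_iff_ne_top.2 htop
  have hg : MemLp (fun z => u ⬝ᵥ (T z - θ)) 2 (P θ) :=
    (memLp_two_iff_integrable_sq hgm.aestronglyMeasurable).2 hgi
  obtain ⟨hsL, hsK⟩ := hinfo s hs v
  -- Unbiasedness says that the mean map is the identity; regularity says that its Jacobian is `E[T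
  -- sᵀ]`.
  have hTsij : ∀ i j, ∫ z, T z i * s z j ∂(P θ) = if i = j then 1 else 0 := by
    intro i j
    have h1 := hder i
    have h2 : HasFDerivAt (fun θ' => ∫ z, T z i ∂(P θ'))
        (ContinuousLinearMap.proj i : (Fin n → ℝ) →L[ℝ] ℝ) θ := by
      simp only [(hT.2 _ i).2]
      exact (ContinuousLinearMap.proj i : (Fin n → ℝ) →L[ℝ] ℝ).hasFDerivAt
    have h3 := congrArg (fun L : (Fin n → ℝ) →L[ℝ] ℝ => L (Pi.single j 1)) (h1.unique h2)
    simpa [Pi.single_apply] using h3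
  have hij : ∀ i j, ∫ z, (T z i - θ i) * s z j ∂(P θ) = if i = j then 1 else 0 := by
    intro i j
    simp only [sub_mul]
    rw [integral_sub (hTs i j) ((hs.integrable j).const_mul _), integral_const_mul,
      hs.integral_eq_zero hP, hTsij]
    simp
  have hcross : ∫ z, (u ⬝ᵥ (T z - θ)) * (s z ⬝ᵥ v) ∂(P θ) = u ⬝ᵥ v := by
    have hi : ∀ i j, Integrable (fun z => (T z i - θ i) * s z j) (P θ) := fun i j => by
      simp only [sub_mul]
      exact (hTs i j).sub ((hs.integrable j).const_mul (θ i))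
    have : ∀ z, (u ⬝ᵥ (T z - θ)) * (s z ⬝ᵥ v) =
        ∑ i, ∑ j, u i * v j * ((T z i - θ i) * s z j) := by
      intro z
      simp only [dotProduct, Finset.sum_mul_sum, Pi.sub_apply]
      exact Finset.sum_congr rfl fun i _ => Finset.sum_congr rfl fun j _ => by ring
    simp only [this]
    rw [integral_finsetSum _ fun i _ => integrable_finsetSum _ fun j _ => (hi i j).const_mul _]
    refine Finset.sum_congr rfl fun i _ => ?_
    rw [integral_finsetSum _ fun j _ => (hi i j).const_mul _]
    simp only [integral_const_mul, hij]
    simp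
  have hCS := sq_integral_mul_le hg hsL
  rw [hcross] at hCS
  have hge : u ⬝ᵥ v ≤ ∫ z, (u ⬝ᵥ (T z - θ)) ^ 2 ∂(P θ) := by
    have h0 : 0 ≤ ∫ z, (u ⬝ᵥ (T z - θ)) ^ 2 ∂(P θ) := integral_nonneg fun z => sq_nonneg _
    rcases huv.eq_or_lt with h | h
    · rwa [← h]
    · rw [hKv, dotProduct_comm] at hsK
      have := hCS.trans (mul_le_mul_of_nonneg_left hsK h0)
      rw [sq] at this
      exact le_of_mul_le_mul_right this h
  rw [← ofReal_integral_eq_lintegral_ofReal hgi (Filter.Eventually.of_forall fun z => sq_nonneg _)]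
  exact ENNReal.ofReal_le_ofReal hge

lemma errorCov_quadForm {n : ℕ} {Z : Type*} [MeasurableSpace Z]
    {P : (Fin n → ℝ) → Measure Z} {θ : Fin n → ℝ} [IsFiniteMeasure (P θ)]
    {T : Z → Fin n → ℝ} (hT : ∀ i, MemLp (fun z => T z i) 2 (P θ)) (v : Fin n → ℝ) :
    v ⬝ᵥ (errorCov P T θ *ᵥ v) = ∫ z, (v ⬝ᵥ (T z - θ)) ^ 2 ∂(P θ) := by
  rw [quadForm_eq_integral_sq (μ := P θ) (s := fun z => T z - θ)
    (J := errorCov P T θ)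
    (fun i => (hT i).sub (memLp_const (θ i))) (fun i j => rfl)]
  simp only [dotProduct_comm]

/-- The vectorwise bound as an inequality in the Loewner order. -/
lemma ErrorCovGE.le_errorCov {n : ℕ} {Z : Type*} [MeasurableSpace Z]
    {P : (Fin n → ℝ) → Measure Z} {θ : Fin n → ℝ} [IsFiniteMeasure (P θ)]
    {T : Z → Fin n → ℝ} {R : Matrix (Fin n) (Fin n) ℝ} (hR : R.IsHermitian)
    (h : ErrorCovGE P T θ R) (hT : ∀ i, MemLp (fun z => T z i) 2 (P θ)) :
    R ≤ errorCov P T θ := by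
  rw [Matrix.le_iff, Matrix.posSemidef_iff_dotProduct_mulVec]
  refine ⟨Matrix.IsHermitian.sub ?_ hR, fun v => ?_⟩
  · ext i j
    simp [errorCov, Matrix.conjTranspose_apply, mul_comm]
  · have hg : MemLp (fun z => (T z - θ) ⬝ᵥ v) 2 (P θ) :=
      memLp_dot (s := fun z => T z - θ) (fun i => (hT i).sub (memLp_const (θ i))) v
    simp only [dotProduct_comm _ v] at hg
    have h1 := h v
    rw [← ofReal_integral_eq_lintegral_ofReal hg.integrable_sq
      (Filter.Eventually.of_forall fun z => sq_nonneg _), ← errorCov_quadForm hT] at h1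
    have h2 : 0 ≤ v ⬝ᵥ (errorCov P T θ *ᵥ v) := by
      rw [errorCov_quadForm hT]; exact integral_nonneg fun z => sq_nonneg _
    rw [star_trivial, Matrix.sub_mulVec, dotProduct_sub, sub_nonneg]
    exact (ENNReal.ofReal_le_ofReal_iff h2).1 h1

/-! ### Uniqueness of the Fisher information -/

/-- The integral of a score over any event is the derivative of the probability of that event, which
depends on the model alone and not on the chosen dominating measure or density. -/
lemma IsScoreAt.ae_eq {ι Z : Type*} [Fintype ι] [DecidableEq ι] [MeasurableSpace Z]
    {P : (ι → ℝ) → Measure Z} {θ : ι → ℝ}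
    {s s' : Z → ι → ℝ} (h : IsScoreAt P θ s) (h' : IsScoreAt P θ s') (i : ι) :
    (fun z => s z i) =ᵐ[P θ] fun z => s' z i := by
  refine (h.integrable i).ae_eq_of_forall_setIntegral_eq _ _ (h'.integrable i) fun A hA _ => ?_
  have hm : Measurable (A.indicator (1 : Z → ℝ)) := measurable_one.indicator hA
  have hb : ∃ C, ∀ z, |A.indicator (1 : Z → ℝ) z| ≤ C :=
    ⟨1, fun z => by by_cases hz : z ∈ A <;> simp [hz]⟩
  have h1 := congrArg (fun L : (ι → ℝ) →L[ℝ] ℝ => L (Pi.single i 1))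
    ((h.hasFDerivAt hm hb).unique (h'.hasFDerivAt hm hb))
  have h2 : ∀ f : Z → ℝ, ∫ z, A.indicator 1 z * f z ∂(P θ) = ∫ z in A, f z ∂(P θ) := by
    intro f
    rw [← integral_indicator hA]
    congr 1
    ext z
    by_cases hz : z ∈ A <;> simp [hz]
  simpa [h2] using h1

/-- `HasFisherInfo` is an existence statement over scores; uniqueness is what permits identifying
the given `J` with an explicitly computed information. -/
lemma HasFisherInfo.unique {ι Z : Type*} [Fintype ι] [DecidableEq ι] [MeasurableSpace Z]
    {P : (ι → ℝ) → Measure Z} {θ : ι → ℝ} {J J' : Matrix ι ι ℝ}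
    (h : HasFisherInfo P θ J) (h' : HasFisherInfo P θ J') : J = J' := by
  obtain ⟨s, hs, -, hJ⟩ := h
  obtain ⟨s', hs', -, hJ'⟩ := h'
  ext i j
  rw [hJ, hJ']
  apply integral_congr_ae
  filter_upwards [hs.ae_eq hs' i, hs.ae_eq hs' j] with z hi hj
  rw [hi, hj]

/-! ### The standard Gaussian measure on `κ → ℝ` -/

section StdGaussian

variable {κ : Type*} [Fintype κ]

/-- It suffices to compare boxes, on which the integral of a product of truncated one-variable
functions factorises. -/
lemma pi_withDensity_ofReal {μ : κ → Measure ℝ} [∀ i, SigmaFinite (μ i)] {f : κ → ℝ → ℝ}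
    (h0 : ∀ i x, 0 ≤ f i x) (hf : ∀ i, Integrable (f i) (μ i)) :
    Measure.pi (fun i => (μ i).withDensity fun x => ENNReal.ofReal (f i x)) =
      (Measure.pi μ).withDensity fun x => ENNReal.ofReal (∏ i, f i (x i)) := by
  apply Measure.pi_eq
  intro s hs
  have hint : Integrable (fun x : κ → ℝ => ∏ i, (s i).indicator (f i) (x i)) (Measure.pi μ) :=
    Integrable.fintype_prod fun i => (hf i).indicator (hs i)
  have hnn : ∀ i x, 0 ≤ (s i).indicator (f i) x := fun i x =>
    Set.indicator_nonneg (fun y _ => h0 i y) x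
  have hind : ∀ x : κ → ℝ, (Set.univ.pi s).indicator
      (fun x => ENNReal.ofReal (∏ i, f i (x i))) x =
      ENNReal.ofReal (∏ i, (s i).indicator (f i) (x i)) := by
    intro x
    by_cases hx : x ∈ Set.univ.pi s
    · rw [Set.indicator_of_mem hx]
      congr 1
      exact Finset.prod_congr rfl fun i _ => (Set.indicator_of_mem (hx i trivial) _).symm
    · rw [Set.indicator_of_notMem hx]
      obtain ⟨i, hi⟩ : ∃ i, x i ∉ s i := by
        simpa [Set.mem_pi] using hx
      rw [Finset.prod_eq_zero (Finset.mem_univ i) (Set.indicator_of_notMem hi _)]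
      simp
  rw [withDensity_apply _ (MeasurableSet.univ_pi hs), ← lintegral_indicator
    (MeasurableSet.univ_pi hs)]
  simp only [hind]
  rw [← ofReal_integral_eq_lintegral_ofReal hint
    (Filter.Eventually.of_forall fun x => Finset.prod_nonneg fun i _ => hnn i _),
    integral_fintype_prod_eq_prod, ENNReal.ofReal_prod_of_nonneg fun i _ =>
      integral_nonneg (hnn i)]
  refine Finset.prod_congr rfl fun i _ => ?_
  rw [withDensity_apply _ (hs i), integral_indicator (hs i),
    ofReal_integral_eq_lintegral_ofReal (hf i).integrableOn
      (Filter.Eventually.of_forall (h0 i))]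

/-- Completing the square: `-x²/2 + bx - b²/2 = -(x - b)²/2`. -/
lemma gaussianReal_withDensity_exp (b : ℝ) :
    (gaussianReal 0 1).withDensity (fun x => ENNReal.ofReal (Real.exp (b * x - b * b / 2))) =
      gaussianReal b 1 := by
  rw [gaussianReal_of_var_ne_zero _ one_ne_zero, gaussianReal_of_var_ne_zero _ one_ne_zero,
    ← withDensity_mul _ (measurable_gaussianPDF 0 1) (by fun_prop)]
  congr 1
  ext x
  simp only [Pi.mul_apply, gaussianPDF]
  rw [← ENNReal.ofReal_mul (gaussianPDFReal_nonneg _ _ _)]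
  congr 1
  simp only [gaussianPDFReal]
  rw [mul_assoc, ← Real.exp_add]
  congr 2
  simp
  ring

variable (κ) in
/-- The standard Gaussian measure on `κ → ℝ`. -/
noncomputable abbrev stdG : Measure (κ → ℝ) := Measure.pi fun _ : κ => gaussianReal 0 1

lemma integrable_exp_mul_self_gaussianReal (b : ℝ) :
    Integrable (fun x => Real.exp (b * x - b * b / 2)) (gaussianReal 0 1) := by
  simp only [Real.exp_sub]
  exact (integrable_exp_mul_gaussianReal b).div_const _

/-- The Cameron–Martin formula for the standard Gaussian measure. -/
lemma stdG_map_add (b : κ → ℝ) :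
    (stdG κ).map (fun x => b + x) =
      (stdG κ).withDensity fun x => ENNReal.ofReal (Real.exp (b ⬝ᵥ x - b ⬝ᵥ b / 2)) := by
  have h1 : (stdG κ).map (fun x => b + x) = Measure.pi fun i => gaussianReal (b i) 1 := by
    have := Measure.pi_map_pi (μ := fun _ : κ => gaussianReal 0 1)
      (f := fun i x => b i + x) (fun i => by fun_prop)
    simp only [gaussianReal_map_const_add, zero_add] at this
    exact this
  have h2 := pi_withDensity_ofReal (μ := fun _ : κ => gaussianReal 0 1)
    (f := fun i x => Real.exp (b i * x - b i * b i / 2))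
    (fun i x => (Real.exp_pos _).le) (fun i => integrable_exp_mul_self_gaussianReal (b i))
  simp only [gaussianReal_withDensity_exp] at h2
  rw [h1, h2]
  congr 1
  ext x
  rw [← Real.exp_sum, Finset.sum_sub_distrib, ← Finset.sum_div]
  rfl

/-- The sup norm is at most the sum of the `|x i|`, so a product of one-dimensional integrals
dominates, and `e^{C|x|} ≤ e^{Cx} + e^{-Cx}`. This is the source of dominating functions for
differentiation under the integral. -/
lemma integrable_exp_norm_stdG {C : ℝ} (hC : 0 ≤ C) :
    Integrable (fun x : κ → ℝ => Real.exp (C * ‖x‖)) (stdG κ) := by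
  have h1 : Integrable (fun x : ℝ => Real.exp (C * |x|)) (gaussianReal 0 1) := by
    refine ((integrable_exp_mul_gaussianReal C).add
      (integrable_exp_mul_gaussianReal (-C))).mono' (by fun_prop)
      (Filter.Eventually.of_forall fun x => ?_)
    simp only [Real.norm_eq_abs, Real.abs_exp, Pi.add_apply]
    rcases abs_cases x with ⟨h, -⟩ | ⟨h, -⟩ <;> rw [h]
    · linarith [Real.exp_pos (-C * x)]
    · rw [mul_neg, ← neg_mul]
      linarith [Real.exp_pos (C * x)]
  have h2 : Integrable (fun x : κ → ℝ => ∏ i, Real.exp (C * |x i|)) (stdG κ) :=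
    Integrable.fintype_prod fun i => h1
  refine h2.mono' (by fun_prop) (Filter.Eventually.of_forall fun x => ?_)
  rw [Real.norm_eq_abs, Real.abs_exp, ← Real.exp_sum, Real.exp_le_exp, ← Finset.mul_sum]
  refine mul_le_mul_of_nonneg_left ?_ hC
  refine (pi_norm_le_iff_of_nonneg (Finset.sum_nonneg fun i _ => abs_nonneg _)).2 fun i => ?_
  exact Finset.single_le_sum (f := fun i => |x i|) (fun i _ => abs_nonneg _) (Finset.mem_univ i)

lemma memLp_eval_stdG (i : κ) : MemLp (fun x : κ → ℝ => x i) 2 (stdG κ) :=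
  (memLp_id_gaussianReal 2).comp_measurePreserving
    (measurePreserving_eval (fun _ : κ => gaussianReal 0 1) i)

lemma integral_eval_stdG (i : κ) : ∫ x : κ → ℝ, x i ∂(stdG κ) = 0 := by
  have := integral_comp_eval (μ := fun _ : κ => gaussianReal 0 1) (i := i) (f := fun x : ℝ => x)
    (by fun_prop)
  rw [this, integral_id_gaussianReal]

lemma integral_eval_mul_eval_stdG [DecidableEq κ] (i j : κ) :
    ∫ x : κ → ℝ, x i * x j ∂(stdG κ) = (1 : Matrix κ κ ℝ) i j := by
  by_cases h : i = j
  · subst h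
    have h1 := integral_comp_eval (μ := fun _ : κ => gaussianReal 0 1) (i := i)
      (f := fun x : ℝ => x * x) (by fun_prop)
    have h2 := variance_fun_id_gaussianReal (μ := 0) (v := 1)
    rw [variance_of_integral_eq_zero (by fun_prop) integral_id_gaussianReal] at h2
    rw [h1, Matrix.one_apply_eq]
    simpa [sq] using h2
  · have hind := (iIndepFun_pi (μ := fun _ : κ => gaussianReal 0 1) (X := fun _ x => x)
      (fun i => by fun_prop)).indepFun h
    have := hind.integral_fun_mul_eq_mul_integral
      (measurable_pi_apply i).aestronglyMeasurable (measurable_pi_apply j).aestronglyMeasurable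
    rw [this, integral_eval_stdG, Matrix.one_apply_ne h, zero_mul]

lemma memLp_mulVec_stdG {α : Type*} (A : Matrix α κ ℝ) (i : α) :
    MemLp (fun x => (A *ᵥ x) i) 2 (stdG κ) :=
  memLp_finsetSum _ fun j _ => (memLp_eval_stdG j).const_mul _

lemma integral_mulVec_stdG {α : Type*} (A : Matrix α κ ℝ) (i : α) :
    ∫ x, (A *ᵥ x) i ∂(stdG κ) = 0 := by
  simp only [Matrix.mulVec, dotProduct]
  rw [integral_finsetSum _ fun j _ => ((memLp_eval_stdG j).integrable one_le_two).const_mul _]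
  simp [integral_const_mul, integral_eval_stdG]

lemma integral_mulVec_mul_mulVec_stdG {α β : Type*} (A : Matrix α κ ℝ) (A' : Matrix β κ ℝ)
    (i : α) (j : β) :
    ∫ x, (A *ᵥ x) i * (A' *ᵥ x) j ∂(stdG κ) = (A * A'ᵀ) i j := by
  classical
  have := dotProduct_mulVec_eq_integral (μ := stdG κ) (s := fun x => x) (t := fun x => x)
    memLp_eval_stdG memLp_eval_stdG (J := 1)
    (fun i j => (integral_eval_mul_eval_stdG i j).symm) (A i) (A' j)
  rw [Matrix.one_mulVec] at this
  have hA : ∀ x, (A *ᵥ x) i * (A' *ᵥ x) j = (x ⬝ᵥ A i) * (x ⬝ᵥ A' j) := fun x => by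
    rw [dotProduct_comm x, dotProduct_comm x]; rfl
  simp only [hA, ← this]
  rfl

end StdGaussian

/-! ### Gaussian shift families -/

section Shift

variable {κ α ι : Type*} [Fintype κ] [Fintype α] [Fintype ι]

lemma map_withDensity_comp {X Y : Type*} [MeasurableSpace X] [MeasurableSpace Y] (μ : Measure X)
    {f : X → Y} (hf : Measurable f) {p : Y → ENNReal} (hp : Measurable p) :
    (μ.withDensity fun x => p (f x)).map f = (μ.map f).withDensity p := by
  ext A hA
  rw [Measure.map_apply hf hA, withDensity_apply _ (hf hA), withDensity_apply _ hA,
    setLIntegral_map hA hp hf]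

/-- The Gaussian shift family `N(c + R Rᵀ B θ, R Rᵀ)`. -/
noncomputable def shiftFamily (c : α → ℝ) (R : Matrix α κ ℝ) (B : Matrix α ι ℝ) (θ : ι → ℝ) :
    Measure (α → ℝ) :=
  (stdG κ).map fun x => c + R *ᵥ (Rᵀ *ᵥ (B *ᵥ θ) + x)

/-- The log-density of the shift family with respect to `N(c, R Rᵀ)`. -/
noncomputable def shiftLogDensity (c : α → ℝ) (R : Matrix α κ ℝ) (B : Matrix α ι ℝ) (θ : ι → ℝ)
    (z : α → ℝ) : ℝ :=
  (B *ᵥ θ) ⬝ᵥ (z - c) - (Rᵀ *ᵥ (B *ᵥ θ)) ⬝ᵥ (Rᵀ *ᵥ (B *ᵥ θ)) / 2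

/-- The score of the shift family. -/
noncomputable def shiftScore (c : α → ℝ) (R : Matrix α κ ℝ) (B : Matrix α ι ℝ) (θ : ι → ℝ)
    (z : α → ℝ) : ι → ℝ :=
  Bᵀ *ᵥ (z - c - R *ᵥ (Rᵀ *ᵥ (B *ᵥ θ)))

variable (c : α → ℝ) (R : Matrix α κ ℝ) (B : Matrix α ι ℝ)

lemma continuous_shiftLogDensity (θ : ι → ℝ) : Continuous (shiftLogDensity c R B θ) := by
  unfold shiftLogDensity
  fun_prop

lemma continuous_shiftScore (θ : ι → ℝ) : Continuous (shiftScore c R B θ) := by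
  unfold shiftScore
  fun_prop

instance isProbabilityMeasure_shiftFamily (θ : ι → ℝ) :
    IsProbabilityMeasure (shiftFamily c R B θ) :=
  Measure.isProbabilityMeasure_map (Continuous.aemeasurable (by fun_prop))

/-- Since the mean displacement `RRᵀBθ` lies in the range of `R`, Cameron–Martin can be applied to
the standard Gaussian before mapping by `R`. The family is therefore dominated by `N(c, RRᵀ)` even
when this law is degenerate. -/
lemma shiftFamily_eq_withDensity (θ : ι → ℝ) :
    shiftFamily c R B θ = ((stdG κ).map fun x => c + R *ᵥ x).withDensity
      fun z => ENNReal.ofReal (Real.exp (shiftLogDensity c R B θ z)) := by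
  have hm : Measurable fun x : κ → ℝ => c + R *ᵥ x := Continuous.measurable (by fun_prop)
  have hp : Measurable fun z => ENNReal.ofReal (Real.exp (shiftLogDensity c R B θ z)) := by
    have := (continuous_shiftLogDensity c R B θ).measurable
    fun_prop
  rw [← map_withDensity_comp _ hm hp]
  have : (fun x => ENNReal.ofReal (Real.exp (shiftLogDensity c R B θ (c + R *ᵥ x)))) =
      fun x => ENNReal.ofReal (Real.exp ((Rᵀ *ᵥ (B *ᵥ θ)) ⬝ᵥ x -
        (Rᵀ *ᵥ (B *ᵥ θ)) ⬝ᵥ (Rᵀ *ᵥ (B *ᵥ θ)) / 2)) := by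
    ext x
    rw [shiftLogDensity, add_sub_cancel_left, Matrix.dotProduct_mulVec (B *ᵥ θ) R x,
      ← Matrix.mulVec_transpose]
  rw [this, ← stdG_map_add, Measure.map_map hm (by fun_prop)]
  rfl

lemma hasFDerivAt_shiftLogDensity (θ : ι → ℝ) (z : α → ℝ) :
    HasFDerivAt (fun θ' => shiftLogDensity c R B θ' z) (dotCLM (shiftScore c R B θ z)) θ := by
  have h1 : HasFDerivAt (fun θ' => dotCLM (Bᵀ *ᵥ (z - c)) θ' -
      (∑ k, (dotCLM ((Rᵀ * B) k) θ') ^ 2) / 2)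
      (dotCLM (Bᵀ *ᵥ (z - c)) - (1 / 2 : ℝ) • ∑ k, (2 * dotCLM ((Rᵀ * B) k) θ) •
        dotCLM ((Rᵀ * B) k)) θ := by
    refine (dotCLM _).hasFDerivAt.sub ?_
    have h2 : HasFDerivAt (fun θ' => ∑ k, (dotCLM ((Rᵀ * B) k) θ') ^ 2)
        (∑ k, (2 * dotCLM ((Rᵀ * B) k) θ) • dotCLM ((Rᵀ * B) k)) θ := by
      refine HasFDerivAt.fun_sum fun k _ => ?_
      simpa using ((dotCLM ((Rᵀ * B) k)).hasFDerivAt (x := θ)).pow 2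
    simpa only [div_eq_inv_mul, mul_one] using h2.const_mul (1 / 2 : ℝ)
  convert h1 using 1
  · ext θ'
    simp only [shiftLogDensity, dotCLM_apply]
    congr 1
    · rw [dotProduct_comm, Matrix.dotProduct_mulVec, ← Matrix.mulVec_transpose]
    · rw [Matrix.mulVec_mulVec]
      simp only [dotProduct, Matrix.mulVec, sq]
  · ext v
    have e1 : ∀ k, (Rᵀ * B) k ⬝ᵥ θ = (Rᵀ *ᵥ (B *ᵥ θ)) k := fun k => by
      rw [Matrix.mulVec_mulVec]; rfl
    have e2 : ∀ k, (Rᵀ * B) k ⬝ᵥ v = (Rᵀ *ᵥ (B *ᵥ v)) k := fun k => by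
      rw [Matrix.mulVec_mulVec]; rfl
    have e3 : (1 / 2 : ℝ) * ∑ k, 2 * (Rᵀ *ᵥ (B *ᵥ θ)) k * (Rᵀ *ᵥ (B *ᵥ v)) k =
        (Bᵀ *ᵥ (R *ᵥ (Rᵀ *ᵥ (B *ᵥ θ)))) ⬝ᵥ v := by
      rw [Matrix.mulVec_transpose B, ← Matrix.dotProduct_mulVec, dotProduct_comm,
        Matrix.dotProduct_mulVec, ← Matrix.mulVec_transpose, dotProduct, Finset.mul_sum]
      exact Finset.sum_congr rfl fun k _ => by ring
    simp only [sub_apply, smul_apply, FunLike.coe_sum,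
      Finset.sum_apply, dotCLM_apply, smul_eq_mul, e1, e2, e3]
    rw [shiftScore, Matrix.mulVec_sub, sub_dotProduct]

lemma exists_norm_mulVec_le {β γ : Type*} [Fintype β] [Fintype γ] (A : Matrix β γ ℝ) :
    ∃ C, 0 ≤ C ∧ ∀ x : γ → ℝ, ‖A *ᵥ x‖ ≤ C * ‖x‖ :=
  ⟨‖LinearMap.toContinuousLinearMap A.mulVecLin‖, norm_nonneg _, fun x =>
    (LinearMap.toContinuousLinearMap A.mulVecLin).le_opNorm x⟩

lemma abs_dotProduct_le {β : Type*} [Fintype β] (a b : β → ℝ) :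
    |a ⬝ᵥ b| ≤ Fintype.card β * ‖a‖ * ‖b‖ := by
  calc |a ⬝ᵥ b| ≤ ∑ i, |a i * b i| := Finset.abs_sum_le_sum_abs _ _
    _ ≤ ∑ _i : β, ‖a‖ * ‖b‖ := Finset.sum_le_sum fun i _ => by
        rw [abs_mul]
        exact mul_le_mul (norm_le_pi_norm a i) (norm_le_pi_norm b i) (abs_nonneg _) (norm_nonneg _)
    _ = _ := by simp [mul_assoc]

lemma norm_dotCLM_le {β : Type*} [Fintype β] (a : β → ℝ) :
    ‖dotCLM a‖ ≤ Fintype.card β * ‖a‖ :=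
  ContinuousLinearMap.opNorm_le_bound _ (by positivity) fun v => by
    rw [dotCLM_apply]; exact abs_dotProduct_le a v

/-- A locally uniform exponential bound for the derivative of the density. -/
lemma exists_norm_shiftDensity_deriv_le (r : ℝ) :
    ∃ C, 0 ≤ C ∧ ∀ θ : ι → ℝ, ‖θ‖ ≤ r → ∀ z,
      Real.exp (shiftLogDensity c R B θ z) * ‖dotCLM (shiftScore c R B θ z)‖ ≤
        C * Real.exp (C * ‖z - c‖) := by
  obtain ⟨CB, hCB0, hCB⟩ := exists_norm_mulVec_le B
  obtain ⟨CT, hCT0, hCT⟩ := exists_norm_mulVec_le Bᵀ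
  obtain ⟨CQ, hCQ0, hCQ⟩ := exists_norm_mulVec_le (R * (Rᵀ * B))
  set K₁ : ℝ := Fintype.card α * (CB * |r|) with hK₁
  set K₂ : ℝ := Fintype.card ι * CT with hK₂
  have hK₁0 : 0 ≤ K₁ := by positivity
  have hK₂0 : 0 ≤ K₂ := by positivity
  -- One number serves as prefactor and as rate: the linear growth of the score is absorbed into
  -- `e^{‖u‖}`, which raises the rate `K₁` to `K₁ + 1`.
  refine ⟨K₁ + 1 + K₂ * (1 + CQ * |r|), by positivity, fun θ hθ z => ?_⟩
  set u := z - c with hu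
  have hθ' : ‖θ‖ ≤ |r| := hθ.trans (le_abs_self r)
  have h1 : shiftLogDensity c R B θ z ≤ K₁ * ‖u‖ := by
    have h2 : (B *ᵥ θ) ⬝ᵥ u ≤ K₁ * ‖u‖ := by
      refine (le_abs_self _).trans ((abs_dotProduct_le _ _).trans ?_)
      rw [hK₁]
      gcongr
      exact (hCB θ).trans (by gcongr)
    have h3 : 0 ≤ (Rᵀ *ᵥ (B *ᵥ θ)) ⬝ᵥ (Rᵀ *ᵥ (B *ᵥ θ)) :=
      Finset.sum_nonneg fun i _ => mul_self_nonneg _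
    rw [shiftLogDensity]
    linarith
  have h2 : ‖dotCLM (shiftScore c R B θ z)‖ ≤ K₂ * (1 + CQ * |r|) * Real.exp ‖u‖ := by
    have h4 : ‖shiftScore c R B θ z‖ ≤ CT * (‖u‖ + CQ * |r|) := by
      refine (hCT _).trans ?_
      gcongr
      refine (norm_sub_le _ _).trans ?_
      gcongr
      rw [Matrix.mulVec_mulVec, Matrix.mulVec_mulVec, Matrix.mul_assoc]
      exact (hCQ θ).trans (by gcongr)
    have h5 : ‖u‖ + CQ * |r| ≤ (1 + CQ * |r|) * Real.exp ‖u‖ := by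
      have e1 : ‖u‖ ≤ Real.exp ‖u‖ := (by linarith : ‖u‖ ≤ ‖u‖ + 1).trans (Real.add_one_le_exp _)
      have e2 : 1 ≤ Real.exp ‖u‖ := Real.one_le_exp (norm_nonneg _)
      have e3 : 0 ≤ CQ * |r| := by positivity
      nlinarith
    calc ‖dotCLM (shiftScore c R B θ z)‖ ≤ Fintype.card ι * ‖shiftScore c R B θ z‖ :=
          norm_dotCLM_le _
      _ ≤ Fintype.card ι * (CT * ((1 + CQ * |r|) * Real.exp ‖u‖)) := by
          gcongr
          exact h4.trans (by gcongr)
      _ = K₂ * (1 + CQ * |r|) * Real.exp ‖u‖ := by rw [hK₂]; ring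
  calc Real.exp (shiftLogDensity c R B θ z) * ‖dotCLM (shiftScore c R B θ z)‖
      ≤ Real.exp (K₁ * ‖u‖) * (K₂ * (1 + CQ * |r|) * Real.exp ‖u‖) :=
        mul_le_mul (Real.exp_le_exp.2 h1) h2 (norm_nonneg _) (Real.exp_pos _).le
    _ = K₂ * (1 + CQ * |r|) * Real.exp ((K₁ + 1) * ‖u‖) := by
        rw [add_mul, one_mul, Real.exp_add]; ring
    _ ≤ _ := by
        have e3 : 0 ≤ K₂ * (1 + CQ * |r|) := by positivity
        refine mul_le_mul (by linarith) (Real.exp_le_exp.2 ?_) (Real.exp_pos _).le (by positivity)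
        exact mul_le_mul_of_nonneg_right (by linarith) (norm_nonneg _)

lemma integrable_exp_norm_map_stdG {C : ℝ} (hC : 0 ≤ C) :
    Integrable (fun z => Real.exp (C * ‖z - c‖)) ((stdG κ).map fun x => c + R *ᵥ x) := by
  rw [integrable_map_measure (Continuous.aestronglyMeasurable (by fun_prop))
    (Continuous.aemeasurable (by fun_prop))]
  obtain ⟨CR, hCR0, hCR⟩ := exists_norm_mulVec_le R
  refine (integrable_exp_norm_stdG (κ := κ) (mul_nonneg hC hCR0)).mono'
    (Continuous.aestronglyMeasurable (by simp only [Function.comp_def]; fun_prop))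
    (Filter.Eventually.of_forall fun x => ?_)
  simp only [Function.comp, add_sub_cancel_left, Real.norm_eq_abs, Real.abs_exp, Real.exp_le_exp]
  rw [mul_assoc]
  exact mul_le_mul_of_nonneg_left (hCR x) hC

/-- In the underlying standard Gaussian coordinate the score is linear and free of `θ`; all its
moments reduce to those of `stdG`. -/
lemma shiftScore_apply (θ : ι → ℝ) (x : κ → ℝ) :
    shiftScore c R B θ (c + R *ᵥ (Rᵀ *ᵥ (B *ᵥ θ) + x)) = (Bᵀ * R) *ᵥ x := by
  rw [shiftScore, Matrix.mulVec_add, add_sub_cancel_left, add_sub_cancel_left,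
    Matrix.mulVec_mulVec]

lemma measurable_shiftMap (θ : ι → ℝ) :
    Measurable fun x : κ → ℝ => c + R *ᵥ (Rᵀ *ᵥ (B *ᵥ θ) + x) :=
  Continuous.measurable (by fun_prop)

variable [DecidableEq ι]

lemma isScoreAt_shiftFamily (θ : ι → ℝ) :
    IsScoreAt (shiftFamily c R B) θ (shiftScore c R B θ) := by
  set ν : Measure (α → ℝ) := (stdG κ).map fun x => c + R *ᵥ x with hν
  have : IsProbabilityMeasure ν :=
    Measure.isProbabilityMeasure_map (Continuous.aemeasurable (by fun_prop))
  let p : (ι → ℝ) → (α → ℝ) → ℝ := fun θ' z => Real.exp (shiftLogDensity c R B θ' z)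
  let D : (ι → ℝ) → (α → ℝ) → (ι → ℝ) →L[ℝ] ℝ := fun θ' z =>
    Real.exp (shiftLogDensity c R B θ' z) • dotCLM (shiftScore c R B θ' z)
  have hp : ∀ θ' z, HasFDerivAt (fun θ' => p θ' z) (D θ' z) θ' := fun θ' z =>
    (hasFDerivAt_shiftLogDensity c R B θ' z).exp
  have hfd : ∀ z, fderiv ℝ (fun θ' => p θ' z) θ = D θ z := fun z => (hp θ z).fderiv
  have hpc : ∀ θ', Continuous (p θ') := fun θ' =>
    Real.continuous_exp.comp (continuous_shiftLogDensity c R B θ')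
  have hDc : Continuous (D θ) := by
    refine (hpc θ).smul ?_
    have := continuous_shiftScore c R B θ
    unfold dotCLM
    fun_prop
  -- The radius `‖θ‖ + 1` covers the unit ball about `θ`, on which the differentiation is dominated.
  obtain ⟨C, hC0, hC⟩ := exists_norm_shiftDensity_deriv_le c R B (‖θ‖ + 1)
  have hDb : ∀ θ' ∈ Metric.ball θ 1, ∀ z, ‖D θ' z‖ ≤ C * Real.exp (C * ‖z - c‖) := by
    intro θ' hθ' z
    simp only [D, norm_smul, Real.norm_eq_abs, Real.abs_exp]
    refine hC θ' ?_ z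
    have h1 : ‖θ' - θ‖ < 1 := by simpa [dist_eq_norm] using hθ'
    have h2 := norm_add_le θ (θ' - θ)
    rw [add_sub_cancel] at h2
    linarith
  have hbi : Integrable (fun z => C * Real.exp (C * ‖z - c‖)) ν :=
    (integrable_exp_norm_map_stdG c R hC0).const_mul C
  have hDi : Integrable (D θ) ν := hbi.mono' hDc.aestronglyMeasurable
    (Filter.Eventually.of_forall fun z => hDb θ (Metric.mem_ball_self one_pos) z)
  have hpi : Integrable (p θ) ν := by
    have h1 : IsFiniteMeasure (ν.withDensity fun z => ENNReal.ofReal (p θ z)) := by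
      rw [hν, ← shiftFamily_eq_withDensity]
      infer_instance
    refine ⟨(hpc θ).aestronglyMeasurable, ?_⟩
    rw [hasFiniteIntegral_iff_ofReal (Filter.Eventually.of_forall fun z => (Real.exp_pos _).le)]
    have := measure_lt_top (ν.withDensity fun z => ENNReal.ofReal (p θ z)) Set.univ
    rwa [withDensity_apply _ MeasurableSet.univ, Measure.restrict_univ] at this
  refine ⟨ν, p, inferInstance, fun θ' => ⟨(hpc θ').measurable, fun z => (Real.exp_pos _).le,
    shiftFamily_eq_withDensity c R B θ'⟩, Filter.Eventually.of_forall fun z =>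
    (hp θ z).differentiableAt, ?_, ?_, ?_⟩
  · simpa only [hfd] using hDi
  · rintro h hm ⟨Ch, hCh⟩
    simp only [hfd]
    refine hasFDerivAt_integral_of_dominated_of_fderiv_le (𝕜 := ℝ)
      (F := fun θ' z => h z * p θ' z) (F' := fun θ' z => h z • D θ' z)
      (bound := fun z => |Ch| * (C * Real.exp (C * ‖z - c‖)))
      (Metric.ball_mem_nhds θ one_pos) (Filter.Eventually.of_forall fun θ' =>
        (hm.mul (hpc θ').measurable).aestronglyMeasurable)
      (hpi.bdd_mul hm.aestronglyMeasurable (Filter.Eventually.of_forall hCh))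
      (hm.aestronglyMeasurable.smul hDc.aestronglyMeasurable)
      (Filter.Eventually.of_forall fun z θ' hθ' => ?_) (hbi.const_mul _)
      (Filter.Eventually.of_forall fun z θ' _ => (hp θ' z).const_mul (h z))
    rw [norm_smul]
    exact mul_le_mul ((hCh z).trans (le_abs_self _)) (hDb θ' hθ' z) (norm_nonneg _) (abs_nonneg _)
  · refine Filter.Eventually.of_forall fun z i => ?_
    simp only [p, Real.log_exp]
    rw [(hasFDerivAt_shiftLogDensity c R B θ z).fderiv, dotCLM_apply]
    simp

lemma hasFisherInfo_shiftFamily (θ : ι → ℝ) :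
    HasFisherInfo (shiftFamily c R B) θ (Bᵀ * (R * Rᵀ) * B) := by
  have hsc := continuous_shiftScore c R B θ
  refine ⟨_, isScoreAt_shiftFamily c R B θ, fun i => ?_, fun i j => ?_⟩
  · rw [shiftFamily, memLp_map_measure_iff (Continuous.aestronglyMeasurable (by fun_prop))
      (measurable_shiftMap c R B θ).aemeasurable]
    simp only [Function.comp_def, shiftScore_apply]
    exact memLp_mulVec_stdG _ i
  · rw [shiftFamily, integral_map (measurable_shiftMap c R B θ).aemeasurable
      (Continuous.aestronglyMeasurable (by fun_prop))]
    simp only [shiftScore_apply]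
    rw [integral_mulVec_mul_mulVec_stdG, Matrix.transpose_mul, Matrix.transpose_transpose]
    simp only [Matrix.mul_assoc]

end Shift

/-! ### Gaussian noise and the Gaussian mechanism -/

section GaussianMechanism

variable {m n : ℕ}

lemma gaussianLaw_eq_map (μ : Fin m → ℝ) (Γ : Matrix (Fin m) (Fin m) ℝ) :
    gaussianLaw μ Γ = (stdG (Fin m)).map fun x => μ + CFC.sqrt Γ *ᵥ x := by
  rw [gaussianLaw, multivariateGaussian, ← map_pi_eq_stdGaussian,
    Measure.map_map (by fun_prop) (by fun_prop), Measure.map_map (by fun_prop) (by fun_prop)]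
  congr 1

instance isProbabilityMeasure_gaussianLaw (μ : Fin m → ℝ) (Γ : Matrix (Fin m) (Fin m) ℝ) :
    IsProbabilityMeasure (gaussianLaw μ Γ) := by
  rw [gaussianLaw_eq_map]
  exact Measure.isProbabilityMeasure_map (Continuous.aemeasurable (by fun_prop))

lemma noise_gaussianMechanism (S : Matrix (Fin m) (Fin m) ℝ) (μ : Fin m → ℝ) :
    (gaussianMechanism S μ).noise = stdG (Fin m) := by
  have h := pi_withDensity_ofReal (μ := fun _ : Fin m => (volume : Measure ℝ))
    (f := fun _ => gaussianPDFReal 0 1) (fun _ => gaussianPDFReal_nonneg 0 1)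
    (fun _ => integrable_gaussianPDFReal 0 1)
  have h1 : (volume : Measure ℝ).withDensity (fun x => ENNReal.ofReal (gaussianPDFReal 0 1 x)) =
      gaussianReal 0 1 := by
    rw [gaussianReal_of_var_ne_zero _ one_ne_zero]
    rfl
  rw [h1] at h
  exact h.symm

/-- Gaussian noise whose location family has a Fisher information is nondegenerate. -/
lemma posDef_of_hasFisherInfo_gaussianLaw {μ η : Fin m → ℝ} {Γ J : Matrix (Fin m) (Fin m) ℝ}
    (hΓ : Γ.PosSemidef) (h : HasFisherInfo (locationFamily (gaussianLaw μ Γ)) η J) :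
    Γ.PosDef := by
  rw [Matrix.posDef_iff_dotProduct_mulVec]
  refine ⟨hΓ.isHermitian, fun u hu => ?_⟩
  refine (hΓ.dotProduct_mulVec_nonneg u).lt_of_ne fun hzero => ?_
  rw [star_trivial] at hzero
  have hsu : CFC.sqrt Γ *ᵥ u = 0 := by
    rw [← sqrt_mul_sqrt hΓ, ← Matrix.mulVec_mulVec, Matrix.dotProduct_mulVec,
      ← Matrix.mulVec_transpose, sqrt_transpose] at hzero
    exact dotProduct_self_eq_zero.1 hzero.symm
  have hux : ∀ x, u ⬝ᵥ (CFC.sqrt Γ *ᵥ x) = 0 := fun x => by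
    rw [Matrix.dotProduct_mulVec, ← Matrix.mulVec_transpose, sqrt_transpose, hsu, zero_dotProduct]
  -- A null direction `u` of `Γ` confines the law to a hyperplane: `A` has probability one at `η`
  -- and zero after any nonzero shift along `u`. This jump contradicts differentiability at `η`.
  let A : Set (Fin m → ℝ) := {x | u ⬝ᵥ x = u ⬝ᵥ (η + μ)}
  have hA : MeasurableSet A := measurableSet_eq_fun (Continuous.measurable (by fun_prop))
    measurable_const
  have hφ : Measurable (A.indicator (1 : (Fin m → ℝ) → ℝ)) := measurable_one.indicator hA
  obtain ⟨L, hL, -⟩ := h.exists_hasFDerivAt (fun _ => inferInstance) hφ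
    ⟨1, fun z => by by_cases hz : z ∈ A <;> simp [hz]⟩
  have huu : u ⬝ᵥ u ≠ 0 := fun h => hu (dotProduct_self_eq_zero.1 h)
  have hval : ∀ t : ℝ, ∫ x, A.indicator (1 : (Fin m → ℝ) → ℝ) x
      ∂(locationFamily (gaussianLaw μ Γ) (η + t • u)) = if t = 0 then 1 else 0 := by
    intro t
    have hmem : ∀ x, η + t • u + (μ + CFC.sqrt Γ *ᵥ x) ∈ A ↔ t = 0 := by
      intro x
      simp only [A, Set.mem_ofPred_eq, dotProduct_add, dotProduct_smul, hux, smul_eq_mul]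
      constructor
      · intro h
        have : t * (u ⬝ᵥ u) = 0 := by linarith
        exact (mul_eq_zero.1 this).resolve_right huu
      · rintro rfl
        ring
    have hφ' : Measurable fun w => A.indicator (1 : (Fin m → ℝ) → ℝ) (η + t • u + w) :=
      hφ.comp (by fun_prop)
    rw [integral_locationFamily _ _ hφ, gaussianLaw_eq_map, integral_map
      (Continuous.aemeasurable (by fun_prop)) hφ'.aestronglyMeasurable]
    simp only [Set.indicator, hmem, Pi.one_apply]
    simp
  have hcont : ContinuousAt (fun t : ℝ => ∫ x, A.indicator (1 : (Fin m → ℝ) → ℝ) x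
      ∂(locationFamily (gaussianLaw μ Γ) (η + t • u))) 0 := by
    have h1 : ContinuousAt (fun t : ℝ => η + t • u) 0 := by fun_prop
    refine ContinuousAt.comp (f := fun t : ℝ => η + t • u) (x := 0)
      (g := fun η' => ∫ x, A.indicator (1 : (Fin m → ℝ) → ℝ) x
        ∂(locationFamily (gaussianLaw μ Γ) η')) ?_ h1
    simpa using hL.continuousAt
  simp only [hval] at hcont
  have h1 : Filter.Tendsto (fun t : ℝ => if t = 0 then (1 : ℝ) else 0)
      (nhdsWithin 0 {0}ᶜ) (nhds 1) := by
    have := hcont.tendsto.mono_left (nhdsWithin_le_nhds (s := {0}ᶜ))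
    simpa using this
  have h2 : Filter.Tendsto (fun t : ℝ => if t = 0 then (1 : ℝ) else 0)
      (nhdsWithin 0 {0}ᶜ) (nhds 0) := by
    refine tendsto_const_nhds.congr' ?_
    filter_upwards [self_mem_nhdsWithin] with t ht
    rw [if_neg (show ¬t = 0 from ht)]
  exact one_ne_zero (tendsto_nhds_unique h1 h2)

/-- The Fisher information of a Gaussian location family is the inverse covariance. -/
lemma fisherInfo_gaussianLaw {μ η : Fin m → ℝ} {Γ J : Matrix (Fin m) (Fin m) ℝ}
    (hΓ : Γ.PosDef) (h : HasFisherInfo (locationFamily (gaussianLaw μ Γ)) η J) : J = Γ⁻¹ := by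
  have hu : IsUnit Γ.det := (Matrix.isUnit_iff_isUnit_det _).1 hΓ.isUnit
  have hRR : CFC.sqrt Γ * (CFC.sqrt Γ)ᵀ = Γ := by
    rw [sqrt_transpose, sqrt_mul_sqrt hΓ.posSemidef]
  -- With `RRᵀ = Γ`, the choice `B = Γ⁻¹` turns the displacement `RRᵀBη'` into `η'`.
  have hfam : locationFamily (gaussianLaw μ Γ) = shiftFamily μ (CFC.sqrt Γ) Γ⁻¹ := by
    ext1 η'
    rw [locationFamily, gaussianLaw_eq_map, shiftFamily,
      Measure.map_map (by fun_prop) (Continuous.measurable (by fun_prop))]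
    congr 1
    ext1 x
    have : CFC.sqrt Γ *ᵥ ((CFC.sqrt Γ)ᵀ *ᵥ (Γ⁻¹ *ᵥ η')) = η' := by
      rw [Matrix.mulVec_mulVec, Matrix.mulVec_mulVec, hRR, Matrix.mul_nonsing_inv _ hu,
        Matrix.one_mulVec]
    rw [Function.comp_apply, Matrix.mulVec_add, this]
    abel
  rw [hfam] at h
  rw [h.unique (hasFisherInfo_shiftFamily μ (CFC.sqrt Γ) Γ⁻¹ η), hRR, Matrix.mul_assoc,
    Matrix.mul_nonsing_inv _ hu, Matrix.mul_one, Matrix.transpose_nonsing_inv]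
  congr 1
  have := hΓ.isHermitian
  rwa [Matrix.IsHermitian, Matrix.conjTranspose_eq_transpose_of_trivial] at this

variable (S : Matrix (Fin m) (Fin m) ℝ) (μ : Fin m → ℝ)

lemma lawGivenY_gaussianMechanism :
    (gaussianMechanism S μ).lawGivenY =
      shiftFamily (-(CFC.sqrt S *ᵥ μ)) (1 : Matrix (Fin m) (Fin m) ℝ) (CFC.sqrt S) := by
  ext1 y
  rw [Mechanism.lawGivenY, noise_gaussianMechanism, shiftFamily]
  congr 1
  ext1 d
  simp only [gaussianMechanism, Matrix.transpose_one, Matrix.one_mulVec, Matrix.mulVec_sub]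
  abel

/-- The output given `y` is a unit Gaussian shifted by `S^{1/2}y`, so its information is exactly `S`
and the constraint is tight at every `y`. -/
lemma private_gaussianMechanism {S : Matrix (Fin m) (Fin m) ℝ} (hS : S.PosSemidef)
    (μ : Fin m → ℝ) : (gaussianMechanism S μ).Private S := by
  intro y
  have h := hasFisherInfo_shiftFamily (-(CFC.sqrt S *ᵥ μ)) (1 : Matrix (Fin m) (Fin m) ℝ)
    (CFC.sqrt S) y
  rw [← lawGivenY_gaussianMechanism, Matrix.transpose_one, Matrix.one_mul, Matrix.mul_one,
    sqrt_transpose, sqrt_mul_sqrt hS] at h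
  exact ⟨S, h, le_rfl⟩

variable (H : Matrix (Fin m) (Fin n) ℝ)

lemma lawGivenWθ_gaussianMechanism (w : Fin m → ℝ) :
    (gaussianMechanism S μ).lawGivenWθ H w =
      shiftFamily (CFC.sqrt S *ᵥ (w - μ)) (1 : Matrix (Fin m) (Fin m) ℝ) (CFC.sqrt S * H) := by
  ext1 θ
  rw [Mechanism.lawGivenWθ, noise_gaussianMechanism, shiftFamily]
  congr 1
  ext1 d
  simp only [gaussianMechanism, Matrix.transpose_one, Matrix.one_mulVec,
    Matrix.mulVec_add (CFC.sqrt S), Matrix.mulVec_sub, ← Matrix.mulVec_mulVec]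
  abel

/-- Given `d`, the covariance `S^{1/2}ΓS^{1/2}` is singular whenever `S` is. The equation `hB`
expresses that the displacement `S^{1/2}Hθ` still stays in its range, as a shift family requires. -/
lemma lawGivenDθ_gaussianMechanism {Γ : Matrix (Fin m) (Fin m) ℝ}
    {W : (Fin n → ℝ) → Measure (Fin m → ℝ)} (hW : ∀ θ, W θ = gaussianLaw μ Γ)
    {B : Matrix (Fin m) (Fin n) ℝ}
    (hB : CFC.sqrt S * CFC.sqrt Γ * (CFC.sqrt S * CFC.sqrt Γ)ᵀ * B = CFC.sqrt S * H)
    (d : Fin m → ℝ) :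
    (gaussianMechanism S μ).lawGivenDθ H W d = shiftFamily d (CFC.sqrt S * CFC.sqrt Γ) B := by
  ext1 θ
  rw [Mechanism.lawGivenDθ, hW, gaussianLaw_eq_map, shiftFamily, Measure.map_map
    (by simp only [gaussianMechanism]; exact Continuous.measurable (by fun_prop))
    (Continuous.measurable (by fun_prop))]
  congr 1
  ext1 x
  rw [Matrix.mulVec_add (CFC.sqrt S * CFC.sqrt Γ), Matrix.mulVec_mulVec, Matrix.mulVec_mulVec,
    hB]
  simp only [gaussianMechanism, Function.comp, ← Matrix.mulVec_mulVec, Matrix.mulVec_add,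
    Matrix.mulVec_sub]
  abel

/-- Measurement noise and privacy noise are treated as one standard Gaussian vector on `Fin m ⊕ Fin
m`; this is the covariance of the output. -/
lemma fromCols_mul_transpose {Γ : Matrix (Fin m) (Fin m) ℝ} (hΓ : Γ.PosSemidef) :
    Matrix.fromCols (CFC.sqrt S * CFC.sqrt Γ) (1 : Matrix (Fin m) (Fin m) ℝ) *
      (Matrix.fromCols (CFC.sqrt S * CFC.sqrt Γ) (1 : Matrix (Fin m) (Fin m) ℝ))ᵀ =
      CFC.sqrt S * Γ * CFC.sqrt S + 1 := by
  rw [Matrix.transpose_fromCols, Matrix.fromCols_mul_fromRows, Matrix.transpose_one,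
    Matrix.mul_one, Matrix.transpose_mul, sqrt_transpose, sqrt_transpose, ← Matrix.mul_assoc,
    Matrix.mul_assoc (CFC.sqrt S), sqrt_mul_sqrt hΓ]

lemma lawGivenθ_gaussianMechanism {Γ : Matrix (Fin m) (Fin m) ℝ} (hΓ : Γ.PosSemidef)
    {W : (Fin n → ℝ) → Measure (Fin m → ℝ)} (hW : ∀ θ, W θ = gaussianLaw μ Γ) :
    (gaussianMechanism S μ).lawGivenθ H W =
      shiftFamily 0 (Matrix.fromCols (CFC.sqrt S * CFC.sqrt Γ) (1 : Matrix (Fin m) (Fin m) ℝ))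
        ((CFC.sqrt S * Γ * CFC.sqrt S + 1)⁻¹ * CFC.sqrt S * H) := by
  ext1 θ
  set Q := CFC.sqrt S * Γ * CFC.sqrt S + 1 with hQ
  have hQu : IsUnit Q.det := (Matrix.isUnit_iff_isUnit_det _).1
    (sqrt_mul_mul_sqrt_add_one_posDef S hΓ).isUnit
  have hf : Measurable fun x : Fin m → ℝ => μ + CFC.sqrt Γ *ᵥ x :=
    Continuous.measurable (by fun_prop)
  have hprod : ((stdG (Fin m)).prod (stdG (Fin m))) =
      (stdG (Fin m ⊕ Fin m)).map (MeasurableEquiv.sumPiEquivProdPi fun _ => ℝ) :=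
    (measurePreserving_sumPiEquivProdPi fun _ : Fin m ⊕ Fin m => gaussianReal 0 1).map_eq.symm
  have hlaw : (W θ).prod (gaussianMechanism S μ).noise =
      ((stdG (Fin m)).prod (stdG (Fin m))).map
        (Prod.map (fun x => μ + CFC.sqrt Γ *ᵥ x) id) := by
    rw [← Measure.map_prod_map _ _ hf measurable_id, Measure.map_id, hW, gaussianLaw_eq_map,
      noise_gaussianMechanism]
  rw [Mechanism.lawGivenθ, hlaw, hprod,
    Measure.map_map (hf.prodMap measurable_id) (MeasurableEquiv.measurable _),
    Measure.map_map ((gaussianMechanism S μ).measurable_output H θ)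
      ((hf.prodMap measurable_id).comp (MeasurableEquiv.measurable _)), shiftFamily]
  congr 1
  ext1 x
  rw [Matrix.mulVec_add (Matrix.fromCols _ _), Matrix.mulVec_mulVec, Matrix.mulVec_mulVec,
    fromCols_mul_transpose S hΓ, ← hQ, ← Matrix.mul_assoc, ← Matrix.mul_assoc,
    Matrix.mul_nonsing_inv _ hQu, Matrix.one_mul, Matrix.fromCols_mulVec, Matrix.one_mulVec]
  simp only [gaussianMechanism, Function.comp_def, Prod.map, id_eq,
    MeasurableEquiv.coe_sumPiEquivProdPi, Equiv.sumPiEquivProdPi_apply, ← Matrix.mulVec_mulVec,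
    Matrix.mulVec_add, Matrix.mulVec_sub]
  abel

/-- The range of `S^{1/2}` equals that of `S^{1/2} Γ S^{1/2}`. -/
lemma exists_sqrt_mul_mul_sqrt_mul_eq {Γ : Matrix (Fin m) (Fin m) ℝ} (hΓ : Γ.PosDef) :
    ∃ B : Matrix (Fin m) (Fin n) ℝ,
      CFC.sqrt S * CFC.sqrt Γ * (CFC.sqrt S * CFC.sqrt Γ)ᵀ * B = CFC.sqrt S * H := by
  set X := CFC.sqrt S * CFC.sqrt Γ with hX
  have hΓu : IsUnit (CFC.sqrt Γ).det := by
    have h := (Matrix.isUnit_iff_isUnit_det _).1 hΓ.isUnit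
    rw [← sqrt_mul_sqrt hΓ.posSemidef, Matrix.det_mul] at h
    exact isUnit_of_mul_isUnit_left h
  have hr : (X * Xᵀ).rank = (CFC.sqrt S).rank := by
    rw [Matrix.rank_self_mul_transpose, hX, Matrix.rank_mul_eq_left_of_isUnit_det _ _ hΓu]
  have hle : (X * Xᵀ).mulVecLin.range ≤ (CFC.sqrt S).mulVecLin.range := by
    rintro _ ⟨x, rfl⟩
    refine ⟨CFC.sqrt Γ *ᵥ (Xᵀ *ᵥ x), ?_⟩
    simp only [Matrix.mulVecLin_apply, hX, Matrix.mulVec_mulVec, Matrix.mul_assoc]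
  -- An inclusion of ranges of equal dimension is an equality, so every column of `S^{1/2}H` is
  -- attained.
  have heq := Submodule.eq_of_le_of_finrank_eq hle hr
  have hcol : ∀ j, ∃ b, (X * Xᵀ) *ᵥ b = CFC.sqrt S *ᵥ (H.col j) := by
    intro j
    have : CFC.sqrt S *ᵥ (H.col j) ∈ (CFC.sqrt S).mulVecLin.range := ⟨_, rfl⟩
    rw [← heq] at this
    exact this
  choose b hb using hcol
  refine ⟨Matrix.of fun i j => b j i, ?_⟩
  ext i j
  exact congrFun (hb j) i

end GaussianMechanism

/-! ### Linear estimators in Gaussian shift families -/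

section LinearEstimator

variable {κ α : Type*} [Fintype κ] [Fintype α] {n : ℕ} {R : Matrix α κ ℝ}
  {B : Matrix α (Fin n) ℝ} {A : Matrix (Fin n) α ℝ}

/-- The hypothesis is the unbiasedness condition for `z ↦ Az`; under it the estimation error is the
centred Gaussian `ARx`, whatever `θ` is. -/
lemma linearEstimator_apply (h : A * (R * Rᵀ) * B = 1) (θ : Fin n → ℝ) (x : κ → ℝ) :
    A *ᵥ (0 + R *ᵥ (Rᵀ *ᵥ (B *ᵥ θ) + x)) = θ + (A * R) *ᵥ x := by
  rw [zero_add, Matrix.mulVec_add, Matrix.mulVec_add, Matrix.mulVec_mulVec x]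
  congr 1
  conv_rhs => rw [← Matrix.one_mulVec θ, ← h]
  simp only [Matrix.mulVec_mulVec, Matrix.mul_assoc]

lemma memLp_linearEstimator (h : A * (R * Rᵀ) * B = 1) (θ : Fin n → ℝ) (i : Fin n) :
    MemLp (fun z => (A *ᵥ z) i) 2 (shiftFamily 0 R B θ) := by
  rw [shiftFamily, memLp_map_measure_iff (Continuous.aestronglyMeasurable (by fun_prop))
    (measurable_shiftMap 0 R B θ).aemeasurable]
  simp only [Function.comp_def, linearEstimator_apply h, Pi.add_apply]
  exact (memLp_const (θ i)).add (memLp_mulVec_stdG _ i)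

lemma isUnbiased_linearEstimator (h : A * (R * Rᵀ) * B = 1) :
    IsUnbiased (shiftFamily 0 R B) (fun z => A *ᵥ z) := by
  refine ⟨Continuous.measurable (by fun_prop), fun θ i =>
    ⟨(memLp_linearEstimator h θ i).integrable one_le_two, ?_⟩⟩
  rw [shiftFamily, integral_map (measurable_shiftMap 0 R B θ).aemeasurable
    (Continuous.aestronglyMeasurable (by fun_prop))]
  simp only [linearEstimator_apply h, Pi.add_apply]
  rw [integral_add (integrable_const _) ((memLp_mulVec_stdG _ i).integrable one_le_two),
    integral_mulVec_stdG]
  simp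

/-- The cross moment of the error `ARx` with the score `BᵀRx` is `ARRᵀB = 1`, the Jacobian of the
mean map of an unbiased estimator. -/
lemma isRegularEstimatorAt_linearEstimator (h : A * (R * Rᵀ) * B = 1) (θ : Fin n → ℝ) :
    IsRegularEstimatorAt (shiftFamily 0 R B) (fun z => A *ᵥ z) θ := by
  have hsc := continuous_shiftScore 0 R B θ
  have hval : ∀ i j, ∫ z, (A *ᵥ z) i * shiftScore 0 R B θ z j ∂(shiftFamily 0 R B θ) =
      (1 : Matrix (Fin n) (Fin n) ℝ) i j := by
    intro i j
    rw [shiftFamily, integral_map (measurable_shiftMap 0 R B θ).aemeasurable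
      (Continuous.aestronglyMeasurable (by fun_prop))]
    have hi : Integrable (fun x => ((A * R) *ᵥ x) i * ((Bᵀ * R) *ᵥ x) j) (stdG κ) :=
      (memLp_mulVec_stdG _ i).integrable_mul (memLp_mulVec_stdG _ j)
    simp only [linearEstimator_apply h, shiftScore_apply, Pi.add_apply, add_mul]
    rw [integral_add (((memLp_mulVec_stdG _ j).integrable one_le_two).const_mul _) hi,
      integral_const_mul,
      integral_mulVec_stdG, integral_mulVec_mul_mulVec_stdG, mul_zero, zero_add, ← h,
      Matrix.transpose_mul, Matrix.transpose_transpose]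
    simp only [Matrix.mul_assoc]
  refine ⟨_, isScoreAt_shiftFamily 0 R B θ, fun i j => ?_, fun i => ?_⟩
  · rw [shiftFamily, integrable_map_measure (Continuous.aestronglyMeasurable (by fun_prop))
      (measurable_shiftMap 0 R B θ).aemeasurable]
    simp only [Function.comp_def, linearEstimator_apply h, shiftScore_apply, Pi.add_apply]
    exact ((memLp_const (θ i)).add (memLp_mulVec_stdG _ i)).integrable_mul (memLp_mulVec_stdG _ j)
  · simp only [((isUnbiased_linearEstimator h).2 _ i).2, hval]
    have hp : ∑ j, (1 : Matrix (Fin n) (Fin n) ℝ) i j •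
        (ContinuousLinearMap.proj j : (Fin n → ℝ) →L[ℝ] ℝ) = ContinuousLinearMap.proj i := by
      simp [Matrix.one_apply]
    rw [hp]
    exact (ContinuousLinearMap.proj i : (Fin n → ℝ) →L[ℝ] ℝ).hasFDerivAt

lemma errorCov_linearEstimator (h : A * (R * Rᵀ) * B = 1) (θ : Fin n → ℝ) :
    errorCov (shiftFamily 0 R B) (fun z => A *ᵥ z) θ = A * (R * Rᵀ) * Aᵀ := by
  ext i j
  rw [errorCov, Matrix.of_apply, shiftFamily,
    integral_map (measurable_shiftMap 0 R B θ).aemeasurable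
      (Continuous.aestronglyMeasurable (by fun_prop))]
  simp only [linearEstimator_apply h, Pi.add_apply, add_sub_cancel_left]
  rw [integral_mulVec_mul_mulVec_stdG, Matrix.transpose_mul]
  simp only [Matrix.mul_assoc]

end LinearEstimator

/-! ### Admissibility of the Gaussian mechanism -/

section Admissible

variable {m n : ℕ}

lemma piecewiseC1_of_contDiff {E F : Type*} [NormedAddCommGroup E] [NormedSpace ℝ E]
    [MeasureSpace E] [NormedAddCommGroup F] [NormedSpace ℝ F] {f : E → F} (hf : ContDiff ℝ 1 f) :
    PiecewiseC1 f :=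
  ⟨Set.univ, isOpen_univ, by simp, hf.contDiffOn⟩

lemma contDiff_mulVec {β γ : Type*} [Fintype β] [Fintype γ] (A : Matrix β γ ℝ) :
    ContDiff ℝ 1 fun x : γ → ℝ => A *ᵥ x :=
  (LinearMap.toContinuousLinearMap A.mulVecLin).contDiff

/-- Evaluated at the output, the score given `d` is linear in `w - μ` and the score given `w` is
linear in `d`. These variables are independent and centred, so the mean of the product factorises
and vanishes. -/
lemma admissible_gaussianMechanism (S : Matrix (Fin m) (Fin m) ℝ) (μ : Fin m → ℝ)
    (H : Matrix (Fin m) (Fin n) ℝ) {Γ : Matrix (Fin m) (Fin m) ℝ} (hΓ : Γ.PosDef)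
    {W : (Fin n → ℝ) → Measure (Fin m → ℝ)} (hW : ∀ θ, W θ = gaussianLaw μ Γ) :
    (gaussianMechanism S μ).Admissible H W := by
  refine ⟨piecewiseC1_of_contDiff ?_, piecewiseC1_of_contDiff ?_, fun θ => ?_⟩
  · exact ((contDiff_mulVec (CFC.sqrt S)).comp (contDiff_fst.sub contDiff_const)).add contDiff_snd
  · have h : ∀ i : Fin m, ContDiff ℝ 1 fun d : Fin m → ℝ => gaussianPDFReal 0 1 (d i) := by
      intro i
      simp only [gaussianPDFReal]
      fun_prop
    exact contDiff_prod (t := Finset.univ) fun i _ => h i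
  obtain ⟨B, hB⟩ := exists_sqrt_mul_mul_sqrt_mul_eq (S := S) (H := H) hΓ
  set X := CFC.sqrt S * CFC.sqrt Γ with hX
  have hsW : ∀ w d, shiftScore (CFC.sqrt S *ᵥ (w - μ)) (1 : Matrix (Fin m) (Fin m) ℝ)
      (CFC.sqrt S * H) θ ((gaussianMechanism S μ).M (H *ᵥ θ + w) d) =
      (CFC.sqrt S * H)ᵀ *ᵥ d := by
    intro w d
    rw [shiftScore]
    congr 1
    simp only [gaussianMechanism, Matrix.transpose_one, Matrix.one_mulVec,
      Matrix.mulVec_add, Matrix.mulVec_sub, ← Matrix.mulVec_mulVec]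
    abel
  have hsD : ∀ w d, shiftScore d X B θ ((gaussianMechanism S μ).M (H *ᵥ θ + w) d) =
      (Bᵀ * CFC.sqrt S) *ᵥ (w - μ) := by
    intro w d
    rw [shiftScore, Matrix.mulVec_mulVec _ X, Matrix.mulVec_mulVec _ (X * Xᵀ), hB,
      ← Matrix.mulVec_mulVec _ Bᵀ]
    congr 1
    simp only [gaussianMechanism, Matrix.mulVec_add, Matrix.mulVec_sub, ← Matrix.mulVec_mulVec]
    abel
  have hmap : ∀ i, MemLp (fun w => ((Bᵀ * CFC.sqrt S) *ᵥ (w - μ)) i) 2 (W θ) ∧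
      ∫ w, ((Bᵀ * CFC.sqrt S) *ᵥ (w - μ)) i ∂(W θ) = 0 := by
    intro i
    rw [hW, gaussianLaw_eq_map]
    constructor
    · rw [memLp_map_measure_iff (Continuous.aestronglyMeasurable (by fun_prop))
        (Continuous.aemeasurable (by fun_prop))]
      simp only [Function.comp_def, add_sub_cancel_left, Matrix.mulVec_mulVec]
      exact memLp_mulVec_stdG _ i
    · rw [integral_map (Continuous.aemeasurable (by fun_prop))
        (Continuous.aestronglyMeasurable (by fun_prop))]
      simp only [add_sub_cancel_left, Matrix.mulVec_mulVec]
      exact integral_mulVec_stdG _ i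
  have hWp : IsProbabilityMeasure (W θ) := by rw [hW]; infer_instance
  refine ⟨fun d => shiftScore d X B θ, fun w => shiftScore (CFC.sqrt S *ᵥ (w - μ))
    (1 : Matrix (Fin m) (Fin m) ℝ) (CFC.sqrt S * H) θ, ?_, ?_, ?_, ?_, fun i j => ?_⟩
  · refine Continuous.measurable ?_
    simp only [Function.uncurry_def, shiftScore]
    fun_prop
  · refine Continuous.measurable ?_
    simp only [Function.uncurry_def, shiftScore]
    fun_prop
  · refine Filter.Eventually.of_forall fun d => ?_
    rw [lawGivenDθ_gaussianMechanism S μ H hW hB]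
    exact isScoreAt_shiftFamily _ _ _ _
  · refine Filter.Eventually.of_forall fun w => ?_
    rw [lawGivenWθ_gaussianMechanism]
    exact isScoreAt_shiftFamily _ _ _ _
  · simp only [hsW, hsD, noise_gaussianMechanism]
    constructor
    · exact ((hmap i).1.integrable one_le_two).mul_prod
        ((memLp_mulVec_stdG ((CFC.sqrt S * H)ᵀ) j).integrable one_le_two)
    · rw [integral_prod_mul (fun w => ((Bᵀ * CFC.sqrt S) *ᵥ (w - μ)) i)
        (fun d => ((CFC.sqrt S * H)ᵀ *ᵥ d) j), (hmap i).2, zero_mul]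

end Admissible

/-! ### Suprema of matrices -/

/-- Polarisation on pairs of basis vectors; this gives the uniqueness clause of `IsMatrixSup`. -/
lemma isSymm_eq_of_quadForm_eq {n : ℕ} {A B : Matrix (Fin n) (Fin n) ℝ} (hA : A.IsSymm)
    (hB : B.IsSymm) (h : ∀ v : Fin n → ℝ, v ⬝ᵥ (A *ᵥ v) = v ⬝ᵥ (B *ᵥ v)) : A = B := by
  have hpol : ∀ {C : Matrix (Fin n) (Fin n) ℝ}, C.IsSymm → ∀ i j,
      (Pi.single i 1 + Pi.single j 1) ⬝ᵥ (C *ᵥ (Pi.single i 1 + Pi.single j 1)) =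
        C i i + 2 * C i j + C j j := by
    intro C hC i j
    have : C j i = C i j := hC.apply i j
    simp [Matrix.mulVec_add, add_dotProduct, dotProduct_add, this]
    ring
  have hdiag : ∀ i, A i i = B i i := fun i => by simpa using h (Pi.single i 1)
  ext i j
  have := h (Pi.single i 1 + Pi.single j 1)
  rw [hpol hA, hpol hB, hdiag i, hdiag j] at this
  linarith

lemma isMatrixSup_of_mem {n : ℕ} {F : Set (Matrix (Fin n) (Fin n) ℝ)}
    {A : Matrix (Fin n) (Fin n) ℝ} (hA : A.IsSymm) (hmem : A ∈ F)
    (hle : ∀ B ∈ F, ∀ v : Fin n → ℝ, v ⬝ᵥ (B *ᵥ v) ≤ v ⬝ᵥ (A *ᵥ v)) : IsMatrixSup F A := by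
  have hlub : ∀ v : Fin n → ℝ, IsLUB ((fun B => v ⬝ᵥ (B *ᵥ v)) '' F) (v ⬝ᵥ (A *ᵥ v)) := by
    intro v
    refine IsGreatest.isLUB ⟨⟨A, hmem, rfl⟩, ?_⟩
    rintro _ ⟨B, hB, rfl⟩
    exact hle B hB v
  exact ⟨⟨hA, hlub⟩, fun A' hA' =>
    isSymm_eq_of_quadForm_eq hA'.1 hA fun v => (hA'.2 v).unique (hlub v)⟩

/-! ### The lower bound and its attainment -/

lemma sigmaPPCR_eq {m n : ℕ} (H : Matrix (Fin m) (Fin n) ℝ) (S J : Matrix (Fin m) (Fin m) ℝ) :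
    sigmaPPCR H S J = (infoMatrix H S J)⁻¹ := rfl

end PPCR

theorem theorem3 {m n : ℕ} (H : Matrix (Fin m) (Fin n) ℝ)
    (S : Matrix (Fin m) (Fin m) ℝ) (hS : S.PosSemidef) (hHSH : IsUnit (Hᵀ * S * H))
    -- the law of the measurement noise `w` given `θ`: finite covariance and `I_w(θ) = 0`
    (W : (Fin n → ℝ) → Measure (Fin m → ℝ)) (hWprob : ∀ θ, IsProbabilityMeasure (W θ))
    (hWcov : ∀ θ i, MemLp (fun w : Fin m → ℝ => w i) 2 (W θ))
    (hW0 : ∀ θ, PPCR.HasFisherInfo W θ 0)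
    (θ : Fin n → ℝ)
    -- `J = I_y(Hθ)`
    (J : Matrix (Fin m) (Fin m) ℝ)
    (hJ : PPCR.HasFisherInfo (PPCR.locationFamily (W θ)) (H *ᵥ θ) J) :
    -- the lower bound
    (∀ (k q : ℕ) (A : PPCR.Mechanism m k q), A.Admissible H W → A.Private S →
      ∀ T : (Fin q → ℝ) → (Fin n → ℝ),
        PPCR.IsUnbiased (A.lawGivenθ H W) T →
        PPCR.IsRegularEstimatorAt (A.lawGivenθ H W) T θ →
        PPCR.ErrorCovGE (A.lawGivenθ H W) T θ (PPCR.sigmaPPCR H S J) ∧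
        ((∀ i, MemLp (fun z => T z i) 2 (A.lawGivenθ H W θ)) →
          PPCR.sigmaPPCR H S J ≤ PPCR.errorCov (A.lawGivenθ H W) T θ)) ∧
    -- attainment under Gaussian measurement noise
    (∀ (μ : Fin m → ℝ) (Γ : Matrix (Fin m) (Fin m) ℝ), Γ.PosSemidef →
      (∀ θ', W θ' = PPCR.gaussianLaw μ Γ) →
      (PPCR.gaussianMechanism S μ).Admissible H W ∧
      (PPCR.gaussianMechanism S μ).Private S ∧
      PPCR.IsUnbiased ((PPCR.gaussianMechanism S μ).lawGivenθ H W)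
        (PPCR.wlsEstimator H S J Γ) ∧
      PPCR.IsRegularEstimatorAt ((PPCR.gaussianMechanism S μ).lawGivenθ H W)
        (PPCR.wlsEstimator H S J Γ) θ ∧
      (∀ i, MemLp (fun z => PPCR.wlsEstimator H S J Γ z i) 2
        ((PPCR.gaussianMechanism S μ).lawGivenθ H W θ)) ∧
      PPCR.errorCov ((PPCR.gaussianMechanism S μ).lawGivenθ H W)
        (PPCR.wlsEstimator H S J Γ) θ = PPCR.sigmaPPCR H S J ∧
      PPCR.IsPrivacyPreservingFisherInfo H W S θ (PPCR.sigmaPPCR H S J)⁻¹) := by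
  have hK := PPCR.infoMatrix_posDef H hS hHSH hJ.posDef_of_locationFamily.posSemidef
  refine ⟨fun k q A _ hA T hT hreg => ?_, fun μ Γ hΓ hW => ?_⟩
  · have hge := PPCR.errorCovGE_inv_of_score_sq_le (A.isProbabilityMeasure_lawGivenθ H hWprob)
      hT hreg hK fun s hs v => hA.score_sq_le hWprob hW0 hS hJ hs v
    have := A.isProbabilityMeasure_lawGivenθ H hWprob θ
    exact ⟨hge, fun hTL => hge.le_errorCov hK.inv.isHermitian hTL⟩
  have hJ' := hJ
  rw [hW θ] at hJ'
  -- `Γ` is only assumed semidefinite; the existence of `J` excludes degenerate noise.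
  have hΓpd := PPCR.posDef_of_hasFisherInfo_gaussianLaw hΓ hJ'
  have hΓu : IsUnit Γ.det := (Matrix.isUnit_iff_isUnit_det _).1 hΓpd.isUnit
  have hJΓ : J⁻¹ = Γ := by
    rw [PPCR.fisherInfo_gaussianLaw hΓpd hJ', Matrix.nonsing_inv_nonsing_inv _ hΓu]
  have hadm := PPCR.admissible_gaussianMechanism S μ H hΓpd hW
  have hpriv := PPCR.private_gaussianMechanism hS μ
  have hlaw := PPCR.lawGivenθ_gaussianMechanism S μ H hΓ hW
  have hRR := PPCR.fromCols_mul_transpose S hΓ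
  set Q := CFC.sqrt S * Γ * CFC.sqrt S + 1 with hQ
  have hQpd : Q.PosDef := PPCR.sqrt_mul_mul_sqrt_add_one_posDef S hΓ
  have hQu : IsUnit Q.det := (Matrix.isUnit_iff_isUnit_det _).1 hQpd.isUnit
  have hQt : Qᵀ = Q := by
    have := hQpd.isHermitian
    rwa [Matrix.IsHermitian, Matrix.conjTranspose_eq_transpose_of_trivial] at this
  set K := PPCR.infoMatrix H S J with hKdef
  have hKu : IsUnit K.det := (Matrix.isUnit_iff_isUnit_det _).1 hK.isUnit
  have hKt : Kᵀ = K := by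
    have := hK.isHermitian
    rwa [Matrix.IsHermitian, Matrix.conjTranspose_eq_transpose_of_trivial] at this
  have hKQ : K = Hᵀ * CFC.sqrt S * (Q⁻¹ * CFC.sqrt S * H) := by
    rw [hKdef, PPCR.infoMatrix, hJΓ, ← hQ]
    simp only [Matrix.mul_assoc]
  set R := Matrix.fromCols (CFC.sqrt S * CFC.sqrt Γ) (1 : Matrix (Fin m) (Fin m) ℝ) with hR
  set B := Q⁻¹ * CFC.sqrt S * H with hB
  set A := K⁻¹ * Hᵀ * CFC.sqrt S * Q⁻¹ with hA
  have hBt : Bᵀ = Hᵀ * CFC.sqrt S * Q⁻¹ := by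
    rw [hB, Matrix.transpose_mul, Matrix.transpose_mul, Matrix.transpose_nonsing_inv, hQt,
      PPCR.sqrt_transpose, Matrix.mul_assoc]
  -- The score at `θ` is `Bᵀz - Kθ`, so `Az - θ` is `K⁻¹` times the score: the equality case of
  -- Cramér–Rao.
  have hAB : A = K⁻¹ * Bᵀ := by
    rw [hA, hBt]
    simp only [Matrix.mul_assoc]
  have hBQ : Bᵀ * Q = Hᵀ * CFC.sqrt S := by
    rw [hBt, Matrix.mul_assoc, Matrix.nonsing_inv_mul _ hQu, Matrix.mul_one]
  have hinfo : Bᵀ * (R * Rᵀ) * B = K := by rw [hRR, hBQ, hKQ]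
  have hAGB : A * (R * Rᵀ) * B = 1 := by
    rw [hAB, Matrix.mul_assoc, Matrix.mul_assoc K⁻¹, ← Matrix.mul_assoc Bᵀ, hinfo,
      Matrix.nonsing_inv_mul _ hKu]
  have hT : PPCR.wlsEstimator H S J Γ = fun z => A *ᵥ z := rfl
  have hF : PPCR.HasFisherInfo ((PPCR.gaussianMechanism S μ).lawGivenθ H W) θ K := by
    rw [hlaw, ← hinfo]
    exact PPCR.hasFisherInfo_shiftFamily _ _ _ _
  refine ⟨hadm, hpriv, ?_, ?_, ?_, ?_, ?_⟩
  · rw [hlaw, hT]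
    exact PPCR.isUnbiased_linearEstimator hAGB
  · rw [hlaw, hT]
    exact PPCR.isRegularEstimatorAt_linearEstimator hAGB θ
  · rw [hlaw, hT]
    exact PPCR.memLp_linearEstimator hAGB θ
  · have hAt : Aᵀ = B * K⁻¹ := by
      rw [congrArg Matrix.transpose hAB, Matrix.transpose_mul, Matrix.transpose_transpose,
        Matrix.transpose_nonsing_inv, hKt]
    rw [hlaw, hT, PPCR.errorCov_linearEstimator hAGB, hAt, ← Matrix.mul_assoc, hAGB,
      Matrix.one_mul]
    rfl
  · rw [PPCR.sigmaPPCR_eq, ← hKdef, Matrix.nonsing_inv_nonsing_inv _ hKu]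
    -- The Gaussian mechanism has information `K`, and `score_sq_le` bounds every competitor by `K`,
    -- so the supremum is attained.
    refine PPCR.isMatrixSup_of_mem hKt ⟨m, m, _, hadm, hpriv, hF⟩ ?_
    rintro I ⟨k, q, C, -, hC, s, hs, hsL, hsI⟩ v
    rw [PPCR.quadForm_eq_integral_sq hsL hsI]
    exact (hC.score_sq_le hWprob hW0 hS hJ hs v).2
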